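/- **Definitions.** A *symmetric lens-shaped network* is a set $M\subset\mathbb R^2$ of the following form. There is a smooth ($C^\infty$ up to the endpoints), regular, injective curve $\gamma:[-1,1]\to\mathbb R^2$ with $\gamma((-1,1))\subset\{x^2>0\}$, with $\gamma(\pm1)\in\{x^2=0\}$ and $x^1(\gamma(-1))<x^1(\gamma(1))$, and with $$\frac{\gamma'(-1)}{|\gamma'(-1)|}=\Big(\tfrac12,\tfrac{\sqrt3}2\Big),\qquad \frac{\gamma'(1)}{|\gamma'(1)|}=\Big(\tfrac12,-\tfrac{\sqrt3}2\Big),$$ and $M$ is the union of $\gamma([-1,1])$, its reflection about the $x^1$-axis, and the two half-lines in the $x^1$-axis that join $\gamma(-1)$ to $-\infty$ and $\gamma(1)$ to $+\infty$. A family $(M_t)_{t\in(-\infty,0)}$ of such networks *solves curve shortening flow* if the curves $\gamma_t$ of $M_t$ can be chosen so that $\gamma$, $\gamma_x$, $\gamma_{xx}$ and $\dot\gamma$ exist and are continuous in $(t,x)\in(-\infty,0)\times[-1,1]$ and, for all $t<0$ and $x\in(-1,1)$, $$\langle\dot\gamma_t,\nu\rangle=\frac{\langle(\gamma_t)_{xx},\nu\rangle}{|(\gamma_t)_x|^2}$$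 for each unit normal $\nu$ of $\gamma_t$ at $x$; that is, the normal velocity is the curvature vector. The family *shrinks self-similarly* if for all $s<t<0$ there is $r\in(0,1)$ with $M_t=r\,M_s$, i.e. $M_t$ is the image of $M_s$ under a contracting homothety centred at the origin. **Theorem.** There exists exactly one self-similarly shrinking family $(N_t)_{t\in(-\infty,0)}$ of symmetric lens-shaped networks that solves curve shortening flow and converges to the $x^1$-axis in Hausdorff distance as $t\nearrow0$. Moreover, every $N_t$ is symmetric with respect to the $x^2$-axis. -/

import Mathlib

open Set Filter Topology
open scoped ContDiff

noncomputable section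

/-- The Euclidean plane; the coordinates `x¹`, `x²` of `p` are `p 0`, `p 1`. -/
abbrev Plane : Type := EuclideanSpace ℝ (Fin 2)

/-- The `x¹`-axis. -/
def x1Axis : Set Plane := {p | p 1 = 0}

/-- Reflection about the `x¹`-axis. -/
def reflectX1 (p : Plane) : Plane := !₂[p 0, -p 1]

/-- Reflection about the `x²`-axis. -/
def reflectX2 (p : Plane) : Plane := !₂[-p 0, p 1]

/-- The closed parameter interval `[-1, 1]`. -/
abbrev paramInterval : Set ℝ := Icc (-1) 1

/-- First derivative of a curve on `[-1, 1]` (one-sided at the endpoints). -/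
def curveDeriv (c : ℝ → Plane) (x : ℝ) : Plane := derivWithin c paramInterval x

/-- Second derivative of a curve on `[-1, 1]` (one-sided at the endpoints). -/
def curveDeriv2 (c : ℝ → Plane) (x : ℝ) : Plane := derivWithin (curveDeriv c) paramInterval x

/-- `c : [-1, 1] → ℝ²` is the upper arc of a symmetric lens-shaped network. Only the values of `c`
on `[-1, 1]` matter. -/
structure IsLensArc (c : ℝ → Plane) : Prop where
  smooth : ContDiffOn ℝ ∞ c paramInterval
  regular : ∀ x ∈ paramInterval, curveDeriv c x ≠ 0
  embedded : InjOn c paramInterval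
  upper : ∀ x ∈ Ioo (-1 : ℝ) 1, 0 < c x 1
  left_mem_axis : c (-1) ∈ x1Axis
  right_mem_axis : c 1 ∈ x1Axis
  left_lt_right : c (-1) 0 < c 1 0
  angle_left : (‖curveDeriv c (-1)‖)⁻¹ • curveDeriv c (-1) = !₂[1 / 2, √3 / 2]
  angle_right : (‖curveDeriv c 1‖)⁻¹ • curveDeriv c 1 = !₂[1 / 2, -(√3 / 2)]

/-- The network with upper arc `c`: the arc, its mirror image about the `x¹`-axis, and the two
half-lines in the `x¹`-axis joining the endpoints of the arc to `-∞` and `+∞`. -/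
def lensNetwork (c : ℝ → Plane) : Set Plane :=
  c '' paramInterval ∪ reflectX1 '' (c '' paramInterval) ∪
    {p | p 1 = 0 ∧ p 0 ≤ c (-1) 0} ∪ {p | p 1 = 0 ∧ c 1 0 ≤ p 0}

/-- The family of arcs `γ t`, `t < 0`, is a solution, of class `C^{2;1}` up to the endpoints, of
curve shortening flow: the normal part of the velocity is the curvature vector. As the lower arc is
the mirror image of the upper one and the half-lines stay in the `x¹`-axis, this is the evolution
equation of the whole network away from the triple points. -/
structure IsCurveShorteningFlow (γ : ℝ → ℝ → Plane) : Prop where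
  continuousOn : ContinuousOn (fun p : ℝ × ℝ => γ p.1 p.2) (Iio 0 ×ˢ paramInterval)
  continuousOn_dx :
    ContinuousOn (fun p : ℝ × ℝ => curveDeriv (γ p.1) p.2) (Iio 0 ×ˢ paramInterval)
  continuousOn_dxx :
    ContinuousOn (fun p : ℝ × ℝ => curveDeriv2 (γ p.1) p.2) (Iio 0 ×ˢ paramInterval)
  differentiable_time :
    ∀ t < 0, ∀ x ∈ paramInterval, DifferentiableAt ℝ (fun s => γ s x) t
  continuousOn_dt :
    ContinuousOn (fun p : ℝ × ℝ => deriv (fun s => γ s p.2) p.1) (Iio 0 ×ˢ paramInterval)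
  flow : ∀ t < 0, ∀ x ∈ Ioo (-1 : ℝ) 1, ∀ ν : Plane, ‖ν‖ = 1 →
    inner ℝ (curveDeriv (γ t) x) ν = 0 →
    inner ℝ (deriv (fun s => γ s x) t) ν =
      inner ℝ (curveDeriv2 (γ t) x) ν / ‖curveDeriv (γ t) x‖ ^ 2

/-- `(N t)`, `t < 0`, is a family of symmetric lens-shaped networks evolving by curve shortening
flow. -/
def IsLensFlow (N : ℝ → Set Plane) : Prop :=
  ∃ γ : ℝ → ℝ → Plane, (∀ t < 0, IsLensArc (γ t) ∧ N t = lensNetwork (γ t)) ∧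
    IsCurveShorteningFlow γ

/-- The family `(N t)`, `t < 0`, shrinks self-similarly: later networks are the images of earlier
ones under contracting homotheties centred at the origin. -/
def ShrinksSelfSimilarly (N : ℝ → Set Plane) : Prop :=
  ∀ s t : ℝ, s < t → t < 0 →
    ∃ r : ℝ, 0 < r ∧ r < 1 ∧ N t = AffineMap.homothety (0 : Plane) r '' N s

/-- `N t` converges to the `x¹`-axis in Hausdorff distance as `t ↗ 0`. The sets are unbounded, so
the distance with values in `[0, ∞]` is used. -/
def ConvergesToX1Axis (N : ℝ → Set Plane) : Prop :=
  Tendsto (fun t => Metric.hausdorffEDist (N t) x1Axis) (𝓝[<] 0) (𝓝 0)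

/-- Self-similarly shrinking families of symmetric lens-shaped networks on `(-∞, 0)` that solve
curve shortening flow and converge to the `x¹`-axis. -/
structure IsShrinkingLensFamily (N : ℝ → Set Plane) : Prop where
  isLensFlow : IsLensFlow N
  shrinks : ShrinksSelfSimilarly N
  converges : ConvergesToX1Axis N

end

/-! A homothetically shrinking arc has curvature vector `μ` times the normal part of its position,
with `μ < 0`; a dilation makes `μ = -1`, so that curvature equals the support function. Parametrise
the arc by the angle `s ∈ [-π/3, π/3]` between its normal and the `x²`-axis. As the radius of
curvature is `h + h''`, the support function satisfies `h'' = 1/h - h`, and the end points lie on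
the axis exactly when `h = ±√3 h'` at `±π/3`. The theorem reduces to this boundary value problem
having exactly one positive solution, which is even.

Evenness (`IsLensProfile.even`): Rolle's theorem for the height gives `s > 0` with `h(s) = h(-s)`,
and conservation of energy gives `h'(s) = ±h'(-s)`. The minus sign makes `h` agree with its
reflection. The plus sign would give period `2s < 2π/3`; since `f = h - 1` satisfies `f'' + 2f ≥ 0`,
a periodic Green's function argument then forces `h = 1`, against the boundary condition.

Uniqueness (`IsLensProfile.unique`): for two even solutions `h`, `k`, take a maximum point `m` of
`k/h + h/k` and set `d = k - ρh` with `ρ = k(m)/h(m)`. Maximality gives `d (d'' + d) ≥ 0`, and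
integration by parts on both sides of `m` forces equality, so `k/h + h/k` is constant. Rolle's
theorem for the Wronskian gives a point with `h = k`, so the constant is 2.

Existence (`exists_isLensProfile`): shooting from `h(0) = a`, `h'(0) = 0` with `a ∈ [1/10, 1]`; the
height at `π/3` changes sign.

It remains to pass from networks to profiles. A shrinking arc has positive support function and is a
graph, so its normal angle is a valid parameter (`IsShrinkingArc.exists_profile`). Self-similarity
is a statement about sets, while the parametrisations are arbitrary; rescaling by the distance `L`
of the triple points produces paths in a fixed trace, and their tangential motion gives the shrinker
equation with `μ = L'/L` (`family_hasShrinkingCurvature`). Finally `L L'` is constant and `L → 0`,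
which fixes the scale as `√(-2t)`. -/

/-! ### Monotonicity from one-variable derivatives -/

section Monotonicity

variable {f f' : ℝ → ℝ} {a b : ℝ}

theorem monotoneOn_Icc_of_hasDerivAt (hc : ContinuousOn f (Icc a b))
    (hd : ∀ x ∈ Ioo a b, HasDerivAt f (f' x) x) (h0 : ∀ x ∈ Ioo a b, 0 ≤ f' x) :
    MonotoneOn f (Icc a b) := by
  apply monotoneOn_of_deriv_nonneg (convex_Icc a b) hc
  · intro x hx
    rw [interior_Icc] at hx
    exact (hd x hx).differentiableAt.differentiableWithinAt
  · intro x hx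
    rw [interior_Icc] at hx
    rw [(hd x hx).deriv]
    exact h0 x hx

theorem antitoneOn_Icc_of_hasDerivAt (hc : ContinuousOn f (Icc a b))
    (hd : ∀ x ∈ Ioo a b, HasDerivAt f (f' x) x) (h0 : ∀ x ∈ Ioo a b, f' x ≤ 0) :
    AntitoneOn f (Icc a b) := by
  have := monotoneOn_Icc_of_hasDerivAt (f := fun x => -f x) (f' := fun x => -f' x) hc.neg
    (fun x hx => (hd x hx).neg) (fun x hx => by simpa using h0 x hx)
  intro x hx y hy hxy
  simpa using this hx hy hxy

theorem strictMonoOn_Icc_of_hasDerivAt (hc : ContinuousOn f (Icc a b))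
    (hd : ∀ x ∈ Ioo a b, HasDerivAt f (f' x) x) (h0 : ∀ x ∈ Ioo a b, 0 < f' x) :
    StrictMonoOn f (Icc a b) := by
  apply strictMonoOn_of_deriv_pos (convex_Icc a b) hc
  intro x hx
  rw [interior_Icc] at hx
  rw [(hd x hx).deriv]
  exact h0 x hx

/-- A function with nonnegative derivative and equal end values has zero derivative. -/
theorem deriv_eq_zero_of_nonneg_of_eq (hc : ContinuousOn f (Icc a b))
    (hd : ∀ x ∈ Ioo a b, HasDerivAt f (f' x) x) (h0 : ∀ x ∈ Ioo a b, 0 ≤ f' x) (hab : f a = f b) :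
    ∀ x ∈ Ioo a b, f' x = 0 := by
  intro x hx
  have hm := monotoneOn_Icc_of_hasDerivAt hc hd h0
  have hle : a ≤ b := hx.1.le.trans hx.2.le
  have hconst : ∀ y ∈ Icc a b, f y = f a := fun y hy =>
    le_antisymm ((hm hy (right_mem_Icc.2 hle) hy.2).trans hab.ge)
      (hm (left_mem_Icc.2 hle) hy hy.1)
  have hev : f =ᶠ[𝓝 x] fun _ => f a := by
    filter_upwards [isOpen_Ioo.mem_nhds hx] with y hy using hconst y (Ioo_subset_Icc_self hy)
  exact (hd x hx).unique ((hasDerivAt_const x (f a)).congr_of_eventuallyEq hev)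

theorem eq_of_hasDerivAt_zero (hc : ContinuousOn f (Icc a b))
    (hd : ∀ x ∈ Ioo a b, HasDerivAt f 0 x) {x y : ℝ} (hx : x ∈ Icc a b) (hy : y ∈ Icc a b) :
    f x = f y := by
  have hm := monotoneOn_Icc_of_hasDerivAt hc hd (fun _ _ => le_rfl)
  have ha := antitoneOn_Icc_of_hasDerivAt hc hd (fun _ _ => le_rfl)
  rcases le_total x y with h | h
  · exact le_antisymm (hm hx hy h) (ha hx hy h)
  · exact le_antisymm (ha hy hx h) (hm hy hx h)

end Monotonicity

theorem HasDerivAt.comp_neg_real {f : ℝ → ℝ} {f' s : ℝ} (hf : HasDerivAt f f' (-s)) :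
    HasDerivAt (fun x => f (-x)) (-f') s :=
  (hf.comp s (hasDerivAt_neg s)).congr_deriv (by ring)

/-! ### The support function of a shrinking lens -/

/-- The interval of normal angles of the upper arc of a lens. -/
abbrev angleInterval : Set ℝ := Icc (-(Real.pi / 3)) (Real.pi / 3)

/-- The support function `h` of the upper arc of a lens moving by `k⃗ = -c^⊥`, as a function of the
angle of the normal with the `x²`-axis, together with its derivative `p`. -/
structure IsLensProfile (h p : ℝ → ℝ) : Prop where
  continuousOn_h : ContinuousOn h angleInterval
  continuousOn_p : ContinuousOn p angleInterval
  pos : ∀ s ∈ angleInterval, 0 < h s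
  deriv_h : ∀ s ∈ Ioo (-(Real.pi / 3)) (Real.pi / 3), HasDerivAt h (p s) s
  deriv_p : ∀ s ∈ Ioo (-(Real.pi / 3)) (Real.pi / 3), HasDerivAt p ((h s)⁻¹ - h s) s
  left : h (-(Real.pi / 3)) = -(√3 * p (-(Real.pi / 3)))
  right : h (Real.pi / 3) = √3 * p (Real.pi / 3)

theorem sub_mul_inv_max_le {δ : ℝ} (hδ : 0 < δ) (x y : ℝ) :
    |(max x δ)⁻¹ - (max y δ)⁻¹| ≤ (δ ^ 2)⁻¹ * |x - y| := by
  have hx : δ ≤ max x δ := le_max_right _ _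
  have hy : δ ≤ max y δ := le_max_right _ _
  have hx0 : 0 < max x δ := hδ.trans_le hx
  have hy0 : 0 < max y δ := hδ.trans_le hy
  rw [inv_sub_inv hx0.ne' hy0.ne', abs_div, abs_of_pos (mul_pos hx0 hy0), div_eq_inv_mul]
  have h1 : |max y δ - max x δ| ≤ |x - y| := by
    rw [abs_sub_comm x y]
    exact abs_max_sub_max_le_abs _ _ _
  have h2 : δ ^ 2 ≤ max x δ * max y δ := by
    rw [sq]; exact mul_le_mul hx hy hδ.le hx0.le
  gcongr

/-- The field of `h'' = 1/h - h` is singular at `h = 0`. A solution bounded below by `δ` also solves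
the truncated equation, to which the global uniqueness theorem for Lipschitz fields applies. -/
theorem lipschitzWith_supportField {δ : ℝ} (hδ : 0 < δ) :
    ∃ K, LipschitzWith K (fun z : ℝ × ℝ => (z.2, (max z.1 δ)⁻¹ - z.1)) := by
  refine ⟨Real.toNNReal ((δ ^ 2)⁻¹ + 1), LipschitzWith.of_dist_le_mul fun z w => ?_⟩
  have h1 : |z.1 - w.1| ≤ dist z w := by rw [← Real.dist_eq]; exact le_max_left _ _
  have h2 : |z.2 - w.2| ≤ dist z w := by rw [← Real.dist_eq]; exact le_max_right _ _
  have h3 := sub_mul_inv_max_le hδ z.1 w.1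
  have hp : 0 ≤ (δ ^ 2)⁻¹ := by positivity
  rw [Real.coe_toNNReal _ (by positivity)]
  refine max_le ?_ ?_
  · rw [Real.dist_eq]
    nlinarith [mul_nonneg hp (dist_nonneg (x := z) (y := w))]
  · rw [Real.dist_eq]
    have : |(max z.1 δ)⁻¹ - z.1 - ((max w.1 δ)⁻¹ - w.1)|
        ≤ |(max z.1 δ)⁻¹ - (max w.1 δ)⁻¹| + |z.1 - w.1| := by
      rw [show (max z.1 δ)⁻¹ - z.1 - ((max w.1 δ)⁻¹ - w.1)
        = ((max z.1 δ)⁻¹ - (max w.1 δ)⁻¹) - (z.1 - w.1) by ring]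
      exact abs_sub _ _
    nlinarith [mul_le_mul_of_nonneg_left h1 hp]

namespace IsLensProfile

variable {h p k q : ℝ → ℝ}

theorem reflect (H : IsLensProfile h p) :
    IsLensProfile (fun s => h (-s)) (fun s => -p (-s)) := by
  have hm : MapsTo (fun s : ℝ => -s) angleInterval angleInterval := fun s hs =>
    ⟨by linarith [hs.2], by linarith [hs.1]⟩
  have hm' : ∀ s ∈ Ioo (-(Real.pi / 3)) (Real.pi / 3), -s ∈ Ioo (-(Real.pi / 3)) (Real.pi / 3) :=
    fun s hs => ⟨by linarith [hs.2], by linarith [hs.1]⟩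
  refine ⟨H.continuousOn_h.comp continuous_neg.continuousOn hm,
    (H.continuousOn_p.comp continuous_neg.continuousOn hm).neg, fun s hs => H.pos _ (hm hs),
    fun s hs => ?_, fun s hs => ?_, ?_, ?_⟩
  · exact (H.deriv_h _ (hm' s hs)).comp_neg_real
  · exact (H.deriv_p _ (hm' s hs)).comp_neg_real.neg.congr_deriv (neg_neg _)
  · simp [H.right]
  · simp [H.left]

theorem exists_pos_le (H : IsLensProfile h p) : ∃ δ > 0, ∀ s ∈ angleInterval, δ ≤ h s := by
  have hne : angleInterval.Nonempty := ⟨0, by constructor <;> linarith [Real.pi_pos]⟩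
  obtain ⟨s, hs, hmin⟩ := isCompact_Icc.exists_isMinOn hne H.continuousOn_h
  exact ⟨h s, H.pos s hs, fun t ht => hmin ht⟩

/-- A profile is determined by its values at one point. -/
theorem eqOn_of_eq (H : IsLensProfile h p) (K : IsLensProfile k q) {s : ℝ}
    (hs : s ∈ Ioo (-(Real.pi / 3)) (Real.pi / 3)) (h1 : h s = k s) (h2 : p s = q s) :
    EqOn h k angleInterval ∧ EqOn p q angleInterval := by
  obtain ⟨δ₁, hδ₁, hh⟩ := H.exists_pos_le
  obtain ⟨δ₂, hδ₂, hk⟩ := K.exists_pos_le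
  set δ := min δ₁ δ₂
  have hδ : 0 < δ := lt_min hδ₁ hδ₂
  obtain ⟨L, hL⟩ := lipschitzWith_supportField hδ
  have key : ∀ {h p : ℝ → ℝ}, IsLensProfile h p → (∀ s ∈ angleInterval, δ ≤ h s) →
      ∀ t ∈ Ioo (-(Real.pi / 3)) (Real.pi / 3), HasDerivAt (fun t => (h t, p t))
        ((p t, (max (h t) δ)⁻¹ - h t) : ℝ × ℝ) t ∧ (h t, p t) ∈ (univ : Set (ℝ × ℝ)) := by
    intro h p H hb t ht
    rw [max_eq_left (hb t (Ioo_subset_Icc_self ht))]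
    exact ⟨(H.deriv_h t ht).prodMk (H.deriv_p t ht), mem_univ _⟩
  have hE : EqOn (fun t => (h t, p t)) (fun t => (k t, q t))
      (Ioo (-(Real.pi / 3)) (Real.pi / 3)) :=
    ODE_solution_unique_of_mem_Ioo
      (v := fun _ => fun z : ℝ × ℝ => (z.2, (max z.1 δ)⁻¹ - z.1)) (s := fun _ => univ)
      (fun t _ => hL.lipschitzOnWith) hs
      (key H fun s hs => (min_le_left _ _).trans (hh s hs))
      (key K fun s hs => (min_le_right _ _).trans (hk s hs)) (by simp [h1, h2])
  have hcl : closure (Ioo (-(Real.pi / 3)) (Real.pi / 3)) = angleInterval :=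
    closure_Ioo (by linarith [Real.pi_pos])
  constructor
  · exact EqOn.of_subset_closure (fun t ht => congrArg Prod.fst (hE ht)) H.continuousOn_h
      K.continuousOn_h Ioo_subset_Icc_self hcl.ge
  · exact EqOn.of_subset_closure (fun t ht => congrArg Prod.snd (hE ht)) H.continuousOn_p
      K.continuousOn_p Ioo_subset_Icc_self hcl.ge

/-- The equation `h'' = 1/h - h` is Newtonian with potential `h²/2 - log h`; the conserved quantity
is twice the energy. -/
theorem energy_eq (H : IsLensProfile h p) {s t : ℝ} (hs : s ∈ angleInterval)
    (ht : t ∈ angleInterval) :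
    p s ^ 2 + h s ^ 2 - 2 * Real.log (h s) = p t ^ 2 + h t ^ 2 - 2 * Real.log (h t) := by
  refine eq_of_hasDerivAt_zero (f := fun s => p s ^ 2 + h s ^ 2 - 2 * Real.log (h s)) ?_ ?_ hs ht
  · exact ((H.continuousOn_p.pow 2).add (H.continuousOn_h.pow 2)).sub
      ((H.continuousOn_h.log fun s hs => (H.pos s hs).ne').const_smul (2 : ℝ))
  · intro x hx
    have hpos := H.pos x (Ioo_subset_Icc_self hx)
    have := (((H.deriv_p x hx).pow 2).add ((H.deriv_h x hx).pow 2)).sub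
      (((H.deriv_h x hx).log hpos.ne').const_mul (2 : ℝ))
    refine this.congr_deriv ?_
    field_simp
    ring

/-! ### Evenness of a profile -/

/-- The second coordinate of the curve has derivative `-sin / h`. -/
theorem hasDerivAt_height (H : IsLensProfile h p) {s : ℝ}
    (hs : s ∈ Ioo (-(Real.pi / 3)) (Real.pi / 3)) :
    HasDerivAt (fun s => h s * Real.cos s - p s * Real.sin s) (-(Real.sin s * (h s)⁻¹)) s := by
  refine (((H.deriv_h s hs).mul (Real.hasDerivAt_cos s)).sub
    ((H.deriv_p s hs).mul (Real.hasDerivAt_sin s))).congr_deriv ?_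
  ring

theorem height_right (H : IsLensProfile h p) :
    h (Real.pi / 3) * Real.cos (Real.pi / 3) - p (Real.pi / 3) * Real.sin (Real.pi / 3) = 0 := by
  rw [H.right, Real.cos_pi_div_three, Real.sin_pi_div_three]; ring

theorem height_left (H : IsLensProfile h p) :
    h (-(Real.pi / 3)) * Real.cos (-(Real.pi / 3))
      - p (-(Real.pi / 3)) * Real.sin (-(Real.pi / 3)) = 0 := by
  rw [H.left, Real.cos_neg, Real.sin_neg, Real.cos_pi_div_three, Real.sin_pi_div_three]; ring

/-- The heights at `s` and `-s` agree for `s = 0` trivially and for `s = π/3` because both end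
points lie on the axis. Their difference has derivative `sin s (1/h(-s) - 1/h(s))`, so Rolle's
theorem applies. -/
theorem exists_eq_neg (H : IsLensProfile h p) : ∃ s ∈ Ioo 0 (Real.pi / 3), h s = h (-s) := by
  have hπ := Real.pi_pos
  have hc : ContinuousOn (fun s => h s * Real.cos s - p s * Real.sin s) angleInterval :=
    (H.continuousOn_h.mul Real.continuous_cos.continuousOn).sub
      (H.continuousOn_p.mul Real.continuous_sin.continuousOn)
  have hsub : Icc 0 (Real.pi / 3) ⊆ angleInterval := Icc_subset_Icc (by linarith) le_rfl
  have hneg : MapsTo (fun s : ℝ => -s) (Icc 0 (Real.pi / 3)) angleInterval := fun s hs =>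
    ⟨by linarith [hs.2], by linarith [hs.1]⟩
  obtain ⟨s, hs, h0⟩ := exists_hasDerivAt_eq_zero
    (f := fun s => (h s * Real.cos s - p s * Real.sin s)
      - (h (-s) * Real.cos (-s) - p (-s) * Real.sin (-s)))
    (f' := fun s => -(Real.sin s * (h s)⁻¹) - (-(-(Real.sin (-s) * (h (-s))⁻¹))))
    (a := 0) (b := Real.pi / 3) (by positivity)
    ((hc.mono hsub).sub (hc.comp continuous_neg.continuousOn hneg))
    (by simp only [neg_zero, sub_self]; rw [H.height_right, H.height_left, sub_zero])
    (fun s hs => (H.hasDerivAt_height ⟨by linarith [hs.1], hs.2⟩).sub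
      (H.hasDerivAt_height (s := -s) ⟨by linarith [hs.2], by linarith [hs.1]⟩).comp_neg_real)
  refine ⟨s, hs, ?_⟩
  have hsin : 0 < Real.sin s := Real.sin_pos_of_pos_of_lt_pi hs.1 (by linarith [hs.2])
  have : Real.sin s * ((h (-s))⁻¹ - (h s)⁻¹) = 0 := by
    rw [Real.sin_neg] at h0; linarith
  rcases mul_eq_zero.1 this with h1 | h1
  · exact absurd h1 hsin.ne'
  · exact (inv_injective (sub_eq_zero.1 h1)).symm

/-- Green's formula for `f'' + 2 f` with `f = h - 1` and a shifted cosine. -/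
theorem green_mono (H : IsLensProfile h p) {a b c : ℝ} (ha : -(Real.pi / 3) ≤ a)
    (hb : b ≤ Real.pi / 3) (hab : a ≤ b)
    (hcos : ∀ s ∈ Ioo a b, 0 ≤ Real.cos (√2 * (s + c))) :
    p a * Real.cos (√2 * (a + c)) + (h a - 1) * (√2 * Real.sin (√2 * (a + c)))
      ≤ p b * Real.cos (√2 * (b + c)) + (h b - 1) * (√2 * Real.sin (√2 * (b + c))) := by
  have hsub : Icc a b ⊆ angleInterval := Icc_subset_Icc ha hb
  -- `√2` is the frequency of the linearisation at the constant solution 1: the equation gives `h''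
  -- + 2(h - 1) = (h - 1)²/h ≥ 0`, and multiplication by the cosine leaves a total derivative on the
  -- left.
  refine monotoneOn_Icc_of_hasDerivAt
    (f := fun s => p s * Real.cos (√2 * (s + c)) + (h s - 1) * (√2 * Real.sin (√2 * (s + c))))
    (f' := fun s => Real.cos (√2 * (s + c)) * ((h s - 1) ^ 2 * (h s)⁻¹)) ?_ ?_ ?_
    (left_mem_Icc.2 hab) (right_mem_Icc.2 hab) hab
  · exact ((H.continuousOn_p.mono hsub).mul (by fun_prop)).add
      (((H.continuousOn_h.mono hsub).sub continuousOn_const).mul (by fun_prop))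
  · intro s hs
    have hs' : s ∈ Ioo (-(Real.pi / 3)) (Real.pi / 3) := ⟨ha.trans_lt hs.1, hs.2.trans_le hb⟩
    have hl : HasDerivAt (fun s => √2 * (s + c)) √2 s := by
      simpa using ((hasDerivAt_id s).add_const c).const_mul √2
    have hpos := H.pos s (Ioo_subset_Icc_self hs')
    refine (((H.deriv_p s hs').mul hl.cos).add
      (((H.deriv_h s hs').sub_const 1).mul (hl.sin.const_mul √2))).congr_deriv ?_
    have h2 : √2 * √2 = 2 := Real.mul_self_sqrt (by norm_num)
    have : (h s)⁻¹ * h s = 1 := inv_mul_cancel₀ hpos.ne'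
    linear_combination (Real.cos (√2 * (s + c)) * (h s - 1)) * h2 +
      (2 - h s) * Real.cos (√2 * (s + c)) * this
  · intro s hs
    have hs' : s ∈ angleInterval := hsub (Ioo_subset_Icc_self hs)
    have := H.pos s hs'
    have := hcos s hs
    positivity

/-- The support function has no period less than `2π/3`. -/
theorem not_periodic (H : IsLensProfile h p) {s : ℝ} (hs : s ∈ Ioo 0 (Real.pi / 3))
    (h1 : h s = h (-s)) (h2 : p s = p (-s)) : False := by
  have hπ := Real.pi_pos
  have hs0 := hs.1
  have hs1 := hs.2
  have hr : 0 < √2 := by positivity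
  have hr2 : √2 < 3 / 2 := by
    rw [Real.sqrt_lt' (by norm_num)]; norm_num
  have hrs : √2 * s < Real.pi / 2 := by nlinarith
  have hsin : 0 < Real.sin (√2 * s) := Real.sin_pos_of_pos_of_lt_pi (by positivity) (by linarith)
  -- The shifts are chosen so that the two cosines agree at `d` and have equal values and slopes at
  -- `-s` and `s`: together they form the periodic Green's function with corner at `d`. It is
  -- nonnegative because `√2 s < π/2`. Adding the inequalities, the terms at `±s` cancel by
  -- periodicity and only the corner term `2 (h d - 1) √2 sin(√2 s) ≥ 0` remains.
  have hge : ∀ d ∈ Icc (-s) s, 1 ≤ h d := by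
    intro d hd
    have e1 := H.green_mono (a := -s) (b := d) (c := s - d) (by linarith) (by linarith [hd.2]) hd.1
      (fun t ht => Real.cos_nonneg_of_neg_pi_div_two_le_of_le
        (by nlinarith [ht.1, ht.2, hd.1, hd.2]) (by nlinarith [ht.1, ht.2, hd.1, hd.2]))
    have e2 := H.green_mono (a := d) (b := s) (c := -d - s) (by linarith [hd.1]) (by linarith) hd.2
      (fun t ht => Real.cos_nonneg_of_neg_pi_div_two_le_of_le
        (by nlinarith [ht.1, ht.2, hd.1, hd.2]) (by nlinarith [ht.1, ht.2, hd.1, hd.2]))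
    rw [show √2 * (-s + (s - d)) = -(√2 * d) by ring, show √2 * (d + (s - d)) = √2 * s by ring,
      Real.cos_neg, Real.sin_neg] at e1
    rw [show √2 * (s + (-d - s)) = -(√2 * d) by ring, show √2 * (d + (-d - s)) = -(√2 * s) by ring,
      Real.cos_neg, Real.sin_neg, Real.cos_neg, Real.sin_neg, h1, h2] at e2
    have : 0 ≤ (h d - 1) * (√2 * Real.sin (√2 * s)) := by linarith
    have := nonneg_of_mul_nonneg_left this (by positivity)
    linarith
  have hsub : Icc (-s) s ⊆ angleInterval := Icc_subset_Icc (by linarith) (by linarith)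
  have hsub' : ∀ t ∈ Ioo (-s) s, t ∈ Ioo (-(Real.pi / 3)) (Real.pi / 3) := fun t ht =>
    ⟨by linarith [ht.1], by linarith [ht.2]⟩
  have hle : ∀ t ∈ Ioo (-s) s, 0 ≤ -((h t)⁻¹ - h t) := by
    intro t ht
    have h3 := hge t (Ioo_subset_Icc_self ht)
    have h4 := inv_le_one_of_one_le₀ h3
    linarith
  -- `p` has equal values at `±s` and nonpositive derivative `1/h - h` in between, so this
  -- derivative vanishes and `h = 1` there.
  have hz := deriv_eq_zero_of_nonneg_of_eq (f := fun t => -p t) (H.continuousOn_p.mono hsub).neg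
    (fun t ht => (H.deriv_p t (hsub' t ht)).neg) hle (by simp [h2])
  have hone : ∀ t ∈ Ioo (-s) s, h t = 1 := by
    intro t ht
    have h3 := hge t (Ioo_subset_Icc_self ht)
    have h4 := inv_le_one_of_one_le₀ h3
    linarith [hz t ht]
  have h0 : (0 : ℝ) ∈ Ioo (-s) s := ⟨by linarith, hs0⟩
  have hp0 : p 0 = 0 := by
    refine (H.deriv_h 0 (hsub' 0 h0)).unique
      ((hasDerivAt_const (0 : ℝ) (1 : ℝ)).congr_of_eventuallyEq ?_)
    filter_upwards [isOpen_Ioo.mem_nhds h0] with t ht using hone t ht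
  have hmem : Real.pi / 3 ∈ angleInterval := ⟨by linarith, le_rfl⟩
  have hE : p (Real.pi / 3) ^ 2 + h (Real.pi / 3) ^ 2 - 2 * Real.log (h (Real.pi / 3)) = 1 := by
    rw [H.energy_eq hmem (Ioo_subset_Icc_self (hsub' 0 h0)), hp0, hone 0 h0]
    simp
  have hpos := H.pos _ hmem
  have h3 : √3 * √3 = 3 := Real.mul_self_sqrt (by norm_num)
  have hlog := Real.log_le_sub_one_of_pos hpos
  have hR := H.right
  have hsq : h (Real.pi / 3) ^ 2 = 3 * p (Real.pi / 3) ^ 2 := by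
    rw [hR]; linear_combination (p (Real.pi / 3) ^ 2) * h3
  -- With `p² = h²/3` and `log h ≤ h - 1`, energy 1 would give `4h²/3 - 2h + 1 ≤ 0`, but this
  -- quadratic has negative discriminant.
  nlinarith [sq_nonneg (h (Real.pi / 3) - 1), sq_nonneg (p (Real.pi / 3))]

/-- The support function of a shrinking lens is even. -/
theorem even (H : IsLensProfile h p) :
    (∀ s ∈ angleInterval, h (-s) = h s) ∧ ∀ s ∈ angleInterval, p (-s) = -p s := by
  obtain ⟨s, hs, h1⟩ := H.exists_eq_neg
  have hmem : s ∈ Ioo (-(Real.pi / 3)) (Real.pi / 3) := ⟨by linarith [hs.1, hs.2], hs.2⟩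
  have hmem' : -s ∈ angleInterval := ⟨by linarith [hs.2], by linarith [hs.1, hs.2]⟩
  have hE := H.energy_eq (Ioo_subset_Icc_self hmem) hmem'
  have hsq : p s ^ 2 = p (-s) ^ 2 := by rw [h1] at hE; linarith
  rcases sq_eq_sq_iff_eq_or_eq_neg.1 hsq with h2 | h2
  · exact (H.not_periodic hs h1 h2).elim
  · obtain ⟨e1, e2⟩ := H.eqOn_of_eq H.reflect hmem h1 h2
    exact ⟨fun t ht => (e1 ht).symm, fun t ht => by rw [e2 ht]; simp⟩

/-! ### Uniqueness of the profile -/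

/-- The quantity `k / h + h / k` of two shrinking lenses is constant: a form of the equality case of
Minkowski's inequality. -/
theorem exists_forall_ratio_eq (H : IsLensProfile h p) (K : IsLensProfile k q) :
    ∃ m, ∀ s ∈ Ioo 0 (Real.pi / 3), k s / h s + h s / k s = m := by
  have hπ := Real.pi_pos
  have hsub : Icc 0 (Real.pi / 3) ⊆ angleInterval := Icc_subset_Icc (by linarith) le_rfl
  have hp0 : p 0 = 0 := by
    have := H.even.2 0 ⟨by linarith, by linarith⟩
    rw [neg_zero] at this; linarith
  have hq0 : q 0 = 0 := by
    have := K.even.2 0 ⟨by linarith, by linarith⟩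
    rw [neg_zero] at this; linarith
  have hh := H.continuousOn_h.mono hsub
  have hk := K.continuousOn_h.mono hsub
  have hpc := H.continuousOn_p.mono hsub
  have hqc := K.continuousOn_p.mono hsub
  have hjc : ContinuousOn (fun s => k s / h s + h s / k s) (Icc 0 (Real.pi / 3)) :=
    (hk.div hh fun s hs => (H.pos s (hsub hs)).ne').add
      (hh.div hk fun s hs => (K.pos s (hsub hs)).ne')
  have hin : ∀ s ∈ Ioo 0 (Real.pi / 3), s ∈ Ioo (-(Real.pi / 3)) (Real.pi / 3) :=
    fun s hs => ⟨by linarith [hs.1], hs.2⟩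
  have h3 : √3 * √3 = 3 := Real.mul_self_sqrt (by norm_num)
  -- The maximum must be attained away from 0, where the cotangent used below is singular. If it is
  -- attained at 0, Rolle's theorem for the height of `k - ρh` with `ρ = k(0)/h(0)` gives `s > 0`
  -- with `h(s)/k(s) = ρ`: the two summands have merely exchanged their values, so `s` is a maximum
  -- point as well.
  obtain ⟨m, hm, hmax⟩ : ∃ m ∈ Ioc 0 (Real.pi / 3),
      IsMaxOn (fun s => k s / h s + h s / k s) (Icc 0 (Real.pi / 3)) m := by
    obtain ⟨m, hm, hmax⟩ := isCompact_Icc.exists_isMaxOn (nonempty_Icc.2 (by positivity)) hjc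
    rcases eq_or_lt_of_le hm.1 with hm0 | hm0
    swap
    · exact ⟨m, ⟨hm0, hm.2⟩, hmax⟩
    subst hm0
    have h0 := H.pos 0 (hsub hm)
    have k0 := K.pos 0 (hsub hm)
    set ρ := k 0 / h 0 with hρ
    obtain ⟨s, hs, hs0⟩ := exists_hasDerivAt_eq_zero (a := 0) (b := Real.pi / 3)
      (f := fun s => (q s - ρ * p s) * Real.sin s - (k s - ρ * h s) * Real.cos s)
      (f' := fun s => ((k s)⁻¹ - ρ * (h s)⁻¹) * Real.sin s) (by positivity)
      (((hqc.sub (continuousOn_const.mul hpc)).mul Real.continuous_sin.continuousOn).sub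
        ((hk.sub (continuousOn_const.mul hh)).mul Real.continuous_cos.continuousOn))
      (by
        simp only [hp0, hq0, H.right, K.right, Real.sin_pi_div_three, Real.cos_pi_div_three, hρ,
          Real.sin_zero, Real.cos_zero]
        field_simp
        ring)
      (fun s hs => by
        refine ((((K.deriv_p s (hin s hs)).sub ((H.deriv_p s (hin s hs)).const_mul ρ)).mul
          (Real.hasDerivAt_sin s)).sub (((K.deriv_h s (hin s hs)).sub
          ((H.deriv_h s (hin s hs)).const_mul ρ)).mul (Real.hasDerivAt_cos s))).congr_deriv ?_
        simp only [Pi.sub_apply]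
        ring)
    refine ⟨s, ⟨hs.1, hs.2.le⟩, fun t ht => ?_⟩
    have hsin : Real.sin s ≠ 0 :=
      (Real.sin_pos_of_pos_of_lt_pi hs.1 (by linarith [hs.2])).ne'
    have hhs := H.pos s (hsub (Ioo_subset_Icc_self hs))
    have hks := K.pos s (hsub (Ioo_subset_Icc_self hs))
    have e1 : (k s)⁻¹ = ρ * (h s)⁻¹ := by
      rcases mul_eq_zero.1 hs0 with h4 | h4
      · linarith
      · exact absurd h4 hsin
    have e2 : h s / k s = ρ := by
      rw [div_eq_mul_inv, e1]; field_simp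
    have e3 : k s / h s = h 0 / k 0 := by
      rw [← inv_div, e2, hρ, inv_div]
    have := hmax ht
    simp only [mem_ofPred_eq] at this ⊢
    rw [e2, e3, hρ, add_comm (h 0 / k 0)]
    exact this
  have hm' : m ∈ Icc 0 (Real.pi / 3) := Ioc_subset_Icc_self hm
  set ρ := k m / h m with hρ
  have hhm := H.pos m (hsub hm')
  have hkm := K.pos m (hsub hm')
  have hρ0 : 0 < ρ := div_pos hkm hhm
  have hdm : k m - ρ * h m = 0 := by rw [hρ]; field_simp; ring
  have hjm : k m / h m + h m / k m = ρ + ρ⁻¹ := by rw [hρ, inv_div]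
  have hjle : ∀ s ∈ Icc 0 (Real.pi / 3), k s / h s + h s / k s ≤ ρ + ρ⁻¹ := fun s hs => by
    rw [← hjm]; exact hmax hs
  -- For `d = k - ρh` the equation is `d'' + d = 1/k - ρ/h`. The identity shows that `d (d'' + d) ≥
  -- 0`, with equality exactly where the maximum is attained.
  have hexp : ∀ s ∈ Icc 0 (Real.pi / 3), (k s - ρ * h s) * ((k s)⁻¹ - ρ * (h s)⁻¹)
      = ρ * (ρ + ρ⁻¹ - (k s / h s + h s / k s)) := by
    intro s hs
    have h1 := (H.pos s (hsub hs)).ne'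
    have h2 := (K.pos s (hsub hs)).ne'
    field_simp
    ring
  have hd : ∀ s ∈ Ioo 0 (Real.pi / 3), HasDerivAt (fun s => k s - ρ * h s) (q s - ρ * p s) s :=
    fun s hs => have hs' : s ∈ Ioo (-(Real.pi / 3)) (Real.pi / 3) := ⟨by linarith [hs.1], hs.2⟩
      (K.deriv_h s hs').sub ((H.deriv_h s hs').const_mul ρ)
  have he : ∀ s ∈ Ioo 0 (Real.pi / 3), HasDerivAt (fun s => q s - ρ * p s)
      ((k s)⁻¹ - k s - ρ * ((h s)⁻¹ - h s)) s :=
    fun s hs => have hs' : s ∈ Ioo (-(Real.pi / 3)) (Real.pi / 3) := ⟨by linarith [hs.1], hs.2⟩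
      (K.deriv_p s hs').sub ((H.deriv_p s hs').const_mul ρ)
  have hdc : ContinuousOn (fun s => k s - ρ * h s) (Icc 0 (Real.pi / 3)) :=
    hk.sub (continuousOn_const.mul hh)
  have hec : ContinuousOn (fun s => q s - ρ * p s) (Icc 0 (Real.pi / 3)) :=
    hqc.sub (continuousOn_const.mul hpc)
  have hcos : ∀ s ∈ Icc 0 (Real.pi / 3), 0 < Real.cos s := fun s hs =>
    Real.cos_pos_of_mem_Ioo ⟨by linarith [hs.1], by linarith [hs.2]⟩
  have hcomb : ∀ s ∈ Icc 0 (Real.pi / 3), ∀ x y, 0 ≤ y →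
      x = (k s - ρ * h s) * ((k s)⁻¹ - ρ * (h s)⁻¹) + y → 0 ≤ x ∧
        (x = 0 → k s / h s + h s / k s = ρ + ρ⁻¹) := by
    intro s hs x y hy hx
    rw [hexp s hs] at hx
    have h1 : 0 ≤ ρ + ρ⁻¹ - (k s / h s + h s / k s) := by linarith [hjle s hs]
    have h2 := mul_nonneg hρ0.le h1
    refine ⟨by linarith, fun h0 => ?_⟩
    have h3 : ρ * (ρ + ρ⁻¹ - (k s / h s + h s / k s)) = 0 := by linarith
    rcases mul_eq_zero.1 h3 with h4 | h4
    · exact absurd h4 hρ0.ne'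
    · linarith
  -- The function `d d' + d² tan s` has derivative `d (d'' + d) + (d' + d tan s)²`, a sum of
  -- nonnegative terms. It vanishes at 0 by evenness and at `m` because `d(m) = 0`, so both terms
  -- vanish in between.
  have hleft : ∀ s ∈ Ioo 0 m, k s / h s + h s / k s = ρ + ρ⁻¹ := by
    have hs1 : ∀ s ∈ Ioo 0 m, s ∈ Ioo 0 (Real.pi / 3) := fun s hs => ⟨hs.1, hs.2.trans_le hm.2⟩
    have hsubm : Icc 0 m ⊆ Icc 0 (Real.pi / 3) := Icc_subset_Icc le_rfl hm.2
    have hform : ∀ s ∈ Ioo 0 m, ((q s - ρ * p s) * (q s - ρ * p s)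
        + (k s - ρ * h s) * ((k s)⁻¹ - k s - ρ * ((h s)⁻¹ - h s)))
        + (2 * (k s - ρ * h s) * (q s - ρ * p s) * (Real.sin s / Real.cos s)
          + (k s - ρ * h s) ^ 2 * (1 / Real.cos s ^ 2))
        = (k s - ρ * h s) * ((k s)⁻¹ - ρ * (h s)⁻¹)
          + ((q s - ρ * p s) + (k s - ρ * h s) * (Real.sin s / Real.cos s)) ^ 2 := by
      intro s hs
      have hc := (hcos s (Ioo_subset_Icc_self (hs1 s hs))).ne'
      have h1 : 1 / Real.cos s ^ 2 = 1 + (Real.sin s / Real.cos s) ^ 2 := by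
        field_simp; linarith [Real.sin_sq_add_cos_sq s]
      rw [h1]; ring
    have hz := deriv_eq_zero_of_nonneg_of_eq (a := 0) (b := m)
      (f := fun s => (k s - ρ * h s) * (q s - ρ * p s)
        + (k s - ρ * h s) ^ 2 * (Real.sin s / Real.cos s))
      (f' := fun s => ((q s - ρ * p s) * (q s - ρ * p s)
        + (k s - ρ * h s) * ((k s)⁻¹ - k s - ρ * ((h s)⁻¹ - h s)))
        + (2 * (k s - ρ * h s) * (q s - ρ * p s) * (Real.sin s / Real.cos s)
          + (k s - ρ * h s) ^ 2 * (1 / Real.cos s ^ 2)))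
      (((hdc.mul hec).add ((hdc.pow 2).mul (Real.continuous_sin.continuousOn.div
        Real.continuous_cos.continuousOn fun s hs => (hcos s hs).ne'))).mono hsubm)
      (fun s hs => by
        have hc := (hcos s (Ioo_subset_Icc_self (hs1 s hs))).ne'
        refine (((hd s (hs1 s hs)).mul (he s (hs1 s hs))).add (((hd s (hs1 s hs)).pow 2).mul
          ((Real.hasDerivAt_sin s).div (Real.hasDerivAt_cos s) hc))).congr_deriv ?_
        have h1 : Real.cos s * Real.cos s - Real.sin s * -Real.sin s = 1 := by
          linarith [Real.sin_sq_add_cos_sq s]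
        rw [h1]
        simp only [Nat.cast_ofNat, Nat.add_one_sub_one, pow_one, Pi.div_apply, Pi.pow_apply])
      (fun s hs => (hcomb s (Ioo_subset_Icc_self (hs1 s hs)) _ _ (sq_nonneg _) (hform s hs)).1)
      (by simp [hp0, hq0, hdm])
    exact fun s hs =>
      (hcomb s (Ioo_subset_Icc_self (hs1 s hs)) _ _ (sq_nonneg _) (hform s hs)).2 (hz s hs)
  -- The same with `d d' - d² cot s`, which vanishes at `π/3` because `d = √3 d'` there.
  have hright : ∀ s ∈ Ioo m (Real.pi / 3), k s / h s + h s / k s = ρ + ρ⁻¹ := by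
    have hs1 : ∀ s ∈ Ioo m (Real.pi / 3), s ∈ Ioo 0 (Real.pi / 3) :=
      fun s hs => ⟨hm.1.trans hs.1, hs.2⟩
    have hsubm : Icc m (Real.pi / 3) ⊆ Icc 0 (Real.pi / 3) := Icc_subset_Icc hm'.1 le_rfl
    have hsin : ∀ s ∈ Icc m (Real.pi / 3), Real.sin s ≠ 0 := fun s hs =>
      (Real.sin_pos_of_pos_of_lt_pi (hm.1.trans_le hs.1) (by linarith [hs.2])).ne'
    have hform : ∀ s ∈ Ioo m (Real.pi / 3), ((q s - ρ * p s) * (q s - ρ * p s)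
        + (k s - ρ * h s) * ((k s)⁻¹ - k s - ρ * ((h s)⁻¹ - h s)))
        - (2 * (k s - ρ * h s) * (q s - ρ * p s) * (Real.cos s / Real.sin s)
          + (k s - ρ * h s) ^ 2 * (-1 / Real.sin s ^ 2))
        = (k s - ρ * h s) * ((k s)⁻¹ - ρ * (h s)⁻¹)
          + ((q s - ρ * p s) - (k s - ρ * h s) * (Real.cos s / Real.sin s)) ^ 2 := by
      intro s hs
      have hc := hsin s (Ioo_subset_Icc_self hs)
      have h1 : -1 / Real.sin s ^ 2 = -(1 + (Real.cos s / Real.sin s) ^ 2) := by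
        field_simp; linarith [Real.sin_sq_add_cos_sq s]
      rw [h1]; ring
    have hz := deriv_eq_zero_of_nonneg_of_eq (a := m) (b := Real.pi / 3)
      (f := fun s => (k s - ρ * h s) * (q s - ρ * p s)
        - (k s - ρ * h s) ^ 2 * (Real.cos s / Real.sin s))
      (f' := fun s => ((q s - ρ * p s) * (q s - ρ * p s)
        + (k s - ρ * h s) * ((k s)⁻¹ - k s - ρ * ((h s)⁻¹ - h s)))
        - (2 * (k s - ρ * h s) * (q s - ρ * p s) * (Real.cos s / Real.sin s)
          + (k s - ρ * h s) ^ 2 * (-1 / Real.sin s ^ 2)))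
      (((hdc.mul hec).mono hsubm).sub (((hdc.mono hsubm).pow 2).mul
        (Real.continuous_cos.continuousOn.div Real.continuous_sin.continuousOn hsin)))
      (fun s hs => by
        have hc := hsin s (Ioo_subset_Icc_self hs)
        refine (((hd s (hs1 s hs)).mul (he s (hs1 s hs))).sub (((hd s (hs1 s hs)).pow 2).mul
          ((Real.hasDerivAt_cos s).div (Real.hasDerivAt_sin s) hc))).congr_deriv ?_
        have h1 : -Real.sin s * Real.sin s - Real.cos s * Real.cos s = -1 := by
          linarith [Real.sin_sq_add_cos_sq s]
        rw [h1]
        simp only [Nat.cast_ofNat, Nat.add_one_sub_one, pow_one, Pi.div_apply, Pi.pow_apply])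
      (fun s hs => (hcomb s (Ioo_subset_Icc_self (hs1 s hs)) _ _ (sq_nonneg _) (hform s hs)).1)
      (by
        simp only [hdm, H.right, K.right, Real.sin_pi_div_three, Real.cos_pi_div_three]
        have : (1 : ℝ) / 2 / (√3 / 2) = √3 / 3 := by
          field_simp; linarith
        rw [this]
        linear_combination (√3 * (q (Real.pi / 3) - ρ * p (Real.pi / 3)) ^ 2 / 3) * h3)
    exact fun s hs =>
      (hcomb s (Ioo_subset_Icc_self (hs1 s hs)) _ _ (sq_nonneg _) (hform s hs)).2 (hz s hs)
  refine ⟨ρ + ρ⁻¹, fun s hs => ?_⟩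
  rcases lt_trichotomy s m with h1 | h1 | h1
  · exact hleft s ⟨hs.1, h1⟩
  · rw [h1, hjm]
  · exact hright s ⟨h1, hs.2⟩

/-- There is at most one shrinking lens. -/
theorem unique (H : IsLensProfile h p) (K : IsLensProfile k q) :
    EqOn h k angleInterval ∧ EqOn p q angleInterval := by
  have hπ := Real.pi_pos
  have hsub : Icc 0 (Real.pi / 3) ⊆ angleInterval := Icc_subset_Icc (by linarith) le_rfl
  have hin : ∀ s ∈ Ioo 0 (Real.pi / 3), s ∈ Ioo (-(Real.pi / 3)) (Real.pi / 3) :=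
    fun s hs => ⟨by linarith [hs.1], hs.2⟩
  have h0 : (0 : ℝ) ∈ Ioo (-(Real.pi / 3)) (Real.pi / 3) := ⟨by linarith, by linarith⟩
  have hp0 : p 0 = 0 := by
    have := H.even.2 0 (Ioo_subset_Icc_self h0)
    rw [neg_zero] at this; linarith
  have hq0 : q 0 = 0 := by
    have := K.even.2 0 (Ioo_subset_Icc_self h0)
    rw [neg_zero] at this; linarith
  obtain ⟨m, hm⟩ := H.exists_forall_ratio_eq K
  -- The Wronskian vanishes at 0 by evenness and at `π/3` because both solutions satisfy the same
  -- linear boundary condition. At a zero of its derivative `k/h - h/k` the solutions agree.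
  obtain ⟨s, hs, hs0⟩ := exists_hasDerivAt_eq_zero (a := 0) (b := Real.pi / 3)
    (f := fun s => p s * k s - q s * h s) (f' := fun s => k s / h s - h s / k s) (by positivity)
    (((H.continuousOn_p.mul K.continuousOn_h).sub
      (K.continuousOn_p.mul H.continuousOn_h)).mono hsub)
    (by simp only [hp0, hq0, H.right, K.right]; ring)
    (fun s hs => by
      refine (((H.deriv_p s (hin s hs)).mul (K.deriv_h s (hin s hs))).sub
        ((K.deriv_p s (hin s hs)).mul (H.deriv_h s (hin s hs)))).congr_deriv ?_
      ring)
  have hpos : ∀ s ∈ Ioo 0 (Real.pi / 3), 0 < h s ∧ 0 < k s := fun s hs =>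
    ⟨H.pos s (Ioo_subset_Icc_self (hin s hs)), K.pos s (Ioo_subset_Icc_self (hin s hs))⟩
  have hm2 : m = 2 := by
    obtain ⟨a, b⟩ := hpos s hs
    have e1 : h s ^ 2 = k s ^ 2 := by
      field_simp at hs0; linarith
    have e2 : h s = k s := (sq_eq_sq₀ a.le b.le).1 e1
    rw [← hm s hs, e2, div_self b.ne']; norm_num
  have heq : ∀ s ∈ Ioo 0 (Real.pi / 3), h s = k s := by
    intro t ht
    obtain ⟨a, b⟩ := hpos t ht
    have e1 := hm t ht
    rw [hm2] at e1
    field_simp at e1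
    have : (h t - k t) ^ 2 = 0 := by linarith
    linarith [pow_eq_zero_iff (two_ne_zero) |>.1 this]
  have hmid : Real.pi / 6 ∈ Ioo 0 (Real.pi / 3) := ⟨by positivity, by linarith⟩
  refine H.eqOn_of_eq K (hin _ hmid) (heq _ hmid) ?_
  refine (H.deriv_h _ (hin _ hmid)).unique
    ((K.deriv_h _ (hin _ hmid)).congr_of_eventuallyEq ?_)
  filter_upwards [isOpen_Ioo.mem_nhds hmid] with t ht using heq t ht

end IsLensProfile

/-! ### Existence of the support function by shooting -/

/-- The force `1/h - h`, modified outside `[1/10, 4]` so as to be bounded and Lipschitz. -/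
noncomputable def cutoffForce (x : ℝ) : ℝ := (max x (1 / 10))⁻¹ - max (1 / 10) (min x 4)

theorem cutoffForce_eq {x : ℝ} (h1 : 1 / 10 ≤ x) (h2 : x ≤ 4) : cutoffForce x = x⁻¹ - x := by
  rw [cutoffForce, max_eq_left h1, min_eq_left h2, max_eq_right h1]

theorem continuous_cutoffForce : Continuous cutoffForce := by
  unfold cutoffForce
  refine ((continuous_id.max continuous_const).inv₀ fun x => ?_).sub (by fun_prop)
  exact (lt_of_lt_of_le (by norm_num) (le_max_right _ _)).ne'

theorem abs_cutoffForce_le (x : ℝ) : |cutoffForce x| ≤ 10 := by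
  have h1 : (max x (1 / 10))⁻¹ ≤ 10 := by
    rw [inv_le_comm₀ (lt_of_lt_of_le (by norm_num) (le_max_right _ _)) (by norm_num)]
    exact le_trans (by norm_num) (le_max_right _ _)
  have h2 : 0 ≤ (max x (1 / 10))⁻¹ := inv_nonneg.2 (le_trans (by norm_num) (le_max_right _ _))
  have h3 : (1 / 10 : ℝ) ≤ max (1 / 10) (min x 4) := le_max_left _ _
  have h4 : max (1 / 10) (min x 4) ≤ 4 := max_le (by norm_num) (min_le_right _ _)
  rw [cutoffForce, abs_le]
  constructor <;> linarith

theorem cutoffForce_pos {x : ℝ} (hx : x < 1) : 0 < cutoffForce x := by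
  have h1 : 1 < (max x (1 / 10))⁻¹ :=
    (one_lt_inv₀ (lt_of_lt_of_le (by norm_num) (le_max_right _ _))).2 (max_lt hx (by norm_num))
  have h4 : max (1 / 10) (min x 4) < 1 := max_lt (by norm_num) (min_lt_of_left_lt hx)
  rw [cutoffForce]
  linarith

theorem cutoffForce_nonpos {x : ℝ} (hx : 1 ≤ x) : cutoffForce x ≤ 0 := by
  have h1 : (max x (1 / 10))⁻¹ ≤ 1 := inv_le_one_of_one_le₀ (hx.trans (le_max_left _ _))
  have h4 : 1 ≤ max (1 / 10) (min x 4) := le_max_of_le_right (le_min hx (by norm_num))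
  rw [cutoffForce]
  linarith

theorem abs_max_min_sub_le (a b x y : ℝ) :
    |max a (min x b) - max a (min y b)| ≤ |x - y| := by
  rw [max_comm a, max_comm a]
  exact (abs_max_sub_max_le_abs _ _ _).trans (abs_inf_sub_inf_le_abs _ _ _)

theorem abs_cutoffForce_sub_le (x y : ℝ) : |cutoffForce x - cutoffForce y| ≤ 101 * |x - y| := by
  have h1 := sub_mul_inv_max_le (δ := 1 / 10) (by norm_num) x y
  have h2 := abs_max_min_sub_le (1 / 10) 4 x y
  have h3 : |cutoffForce x - cutoffForce y| ≤ |(max x (1 / 10))⁻¹ - (max y (1 / 10))⁻¹|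
      + |max (1 / 10) (min x 4) - max (1 / 10) (min y 4)| := by
    rw [show cutoffForce x - cutoffForce y = ((max x (1 / 10))⁻¹ - (max y (1 / 10))⁻¹)
      - (max (1 / 10) (min x 4) - max (1 / 10) (min y 4)) by simp only [cutoffForce]; ring]
    exact abs_sub _ _
  norm_num at h1 h2 h3 ⊢
  linarith

/-! ### Energy barrier for the shooting problem -/

/-- The antiderivative of the modified force. -/
noncomputable def cutoffPotential (x : ℝ) : ℝ := ∫ y in (1 : ℝ)..x, cutoffForce y

theorem hasDerivAt_cutoffPotential (x : ℝ) : HasDerivAt cutoffPotential (cutoffForce x) x :=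
  (continuous_cutoffForce.integral_hasStrictDerivAt 1 x).hasDerivAt

theorem cutoffPotential_lt {x y : ℝ} (hxy : x < y) (hy : y ≤ 1) :
    cutoffPotential x < cutoffPotential y :=
  strictMonoOn_Icc_of_hasDerivAt (a := x) (b := y)
    (fun z _ => (hasDerivAt_cutoffPotential z).continuousAt.continuousWithinAt)
    (fun z _ => hasDerivAt_cutoffPotential z)
    (fun _ hz => cutoffForce_pos (hz.2.trans_le hy)) (left_mem_Icc.2 hxy.le)
    (right_mem_Icc.2 hxy.le) hxy

theorem cutoffPotential_le {x y : ℝ} (hx : 1 ≤ x) (hxy : x ≤ y) :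
    cutoffPotential y ≤ cutoffPotential x :=
  antitoneOn_Icc_of_hasDerivAt (a := x) (b := y)
    (fun z _ => (hasDerivAt_cutoffPotential z).continuousAt.continuousWithinAt)
    (fun z _ => hasDerivAt_cutoffPotential z)
    (fun _ hz => cutoffForce_nonpos (hx.trans hz.1.le)) (left_mem_Icc.2 hxy)
    (right_mem_Icc.2 hxy) hxy

/-- This is the barrier that keeps solutions started at rest in `[1/10, 1]` below 3. On `[1/10, 4]`
the potential is `log x - x²/2` up to a constant, so `log 30 < 4` suffices. -/
theorem cutoffPotential_three_lt : cutoffPotential 3 < cutoffPotential (1 / 10) := by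
  have h := eq_of_hasDerivAt_zero (a := 1 / 10) (b := 4)
    (f := fun x => cutoffPotential x - (Real.log x - x ^ 2 / 2))
    (fun z hz => by
      have : z ≠ 0 := (lt_of_lt_of_le (by norm_num) hz.1).ne'
      exact ((hasDerivAt_cutoffPotential z).continuousAt.sub
        ((Real.continuousAt_log this).sub (by fun_prop))).continuousWithinAt)
    (fun z hz => by
      have : z ≠ 0 := (lt_of_lt_of_le (by norm_num) hz.1.le).ne'
      refine ((hasDerivAt_cutoffPotential z).sub ((Real.hasDerivAt_log this).sub
        (((hasDerivAt_id z).pow 2).div_const 2))).congr_deriv ?_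
      rw [cutoffForce_eq hz.1.le hz.2.le]
      simp)
    (x := 3) (y := 1 / 10) ⟨by norm_num, by norm_num⟩ ⟨by norm_num, by norm_num⟩
  have hlog : Real.log 3 - Real.log (1 / 10) < 4 := by
    rw [← Real.log_div (by norm_num) (by norm_num), Real.log_lt_iff_lt_exp (by norm_num)]
    have : Real.exp 4 = Real.exp 1 ^ 4 := by rw [← Real.exp_nat_mul]; norm_num
    rw [this]
    have h2 : (2.7 : ℝ) < Real.exp 1 := lt_trans (by norm_num) Real.exp_one_gt_d9
    calc (3 / (1 / 10) : ℝ) < 2.7 ^ 4 := by norm_num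
      _ < Real.exp 1 ^ 4 := by gcongr
  norm_num at h hlog ⊢
  linarith

/-- The flow of the support function equation for initial data `(a, 0)`, `a ∈ [1/10, 1]`. -/
theorem exists_support_flow : ∃ α : ℝ → ℝ → ℝ × ℝ,
    (∀ a ∈ Icc (1 / 10 : ℝ) 1, α a 0 = (a, 0) ∧ ∀ s ∈ Ioo (-(11 / 10) : ℝ) (11 / 10),
      HasDerivAt (fun s => (α a s).1) (α a s).2 s ∧
      HasDerivAt (fun s => (α a s).2) ((α a s).1⁻¹ - (α a s).1) s ∧
      a ≤ (α a s).1 ∧ (α a s).1 ≤ 3) ∧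
    ∀ s ∈ Ioo (-(11 / 10) : ℝ) (11 / 10), ContinuousOn (fun a => α a s) (Icc (1 / 10) 1) := by
  have h0 : (0 : ℝ) ∈ Icc (-(11 / 10) : ℝ) (11 / 10) := by constructor <;> norm_num
  -- The force is at most 10 and time at most 11/10, so `|p| ≤ 11` and the clamp on `p` is never
  -- active. The initial data fill a ball of radius 9/10 about `(1, 0)`, and `13 = 9/10 + 11 ·
  -- 11/10` is the radius that a field bounded by 11 requires.
  have hPL : IsPicardLindelof (fun _ : ℝ => fun z : ℝ × ℝ =>
      (max (-11) (min z.2 11), cutoffForce z.1)) (tmin := -(11 / 10)) (tmax := 11 / 10)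
      ⟨0, h0⟩ ((1 : ℝ), (0 : ℝ)) 13 (9 / 10) 11 101 := by
    refine ⟨fun t _ => LipschitzWith.lipschitzOnWith ?_, fun x _ => continuousOn_const,
      fun t _ z _ => ?_, ?_⟩
    · refine LipschitzWith.of_dist_le_mul fun z w => ?_
      have h1 : |z.1 - w.1| ≤ dist z w := by rw [← Real.dist_eq]; exact le_max_left _ _
      have h2 : |z.2 - w.2| ≤ dist z w := by rw [← Real.dist_eq]; exact le_max_right _ _
      have h3 := abs_cutoffForce_sub_le z.1 w.1
      have h4 := abs_max_min_sub_le (-11) 11 z.2 w.2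
      have hd := dist_nonneg (x := z) (y := w)
      simp only [NNReal.coe_ofNat]
      refine max_le ?_ ?_
      · rw [Real.dist_eq]; simp only; linarith
      · rw [Real.dist_eq]; simp only; linarith
    · refine max_le ?_ ?_
      · simp only [Real.norm_eq_abs, NNReal.coe_ofNat, abs_le]
        exact ⟨le_max_left _ _, max_le (by norm_num) (min_le_right _ _)⟩
      · simp only [Real.norm_eq_abs, NNReal.coe_ofNat]
        linarith [abs_cutoffForce_le z.1]
    · norm_num
  obtain ⟨β, hβ, hβc⟩ := hPL.exists_forall_mem_closedBall_eq_hasDerivWithinAt_continuousOn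
  have hball : ∀ a ∈ Icc (1 / 10 : ℝ) 1,
      ((a, 0) : ℝ × ℝ) ∈ Metric.closedBall ((1 : ℝ), (0 : ℝ)) ((9 / 10 : NNReal) : ℝ) := by
    intro a ha
    rw [Metric.mem_closedBall, Prod.dist_eq, Real.dist_eq, dist_self]
    refine max_le ?_ (by positivity)
    push_cast
    rw [abs_le]
    constructor <;> linarith [ha.1, ha.2]
  refine ⟨fun a s => β ((a, 0), s), fun a ha => ?_, fun s hs => ?_⟩
  swap
  · exact hβc.comp (by fun_prop) fun a ha => ⟨hball a ha, Ioo_subset_Icc_self hs⟩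
  obtain ⟨hi, hd⟩ := hβ _ (hball a ha)
  refine ⟨hi, ?_⟩
  set h : ℝ → ℝ := fun s => (β ((a, 0), s)).1 with hh
  set p : ℝ → ℝ := fun s => (β ((a, 0), s)).2 with hp
  have hdp : ∀ s ∈ Icc (-(11 / 10) : ℝ) (11 / 10),
      HasDerivWithinAt p (cutoffForce (h s)) (Icc (-(11 / 10)) (11 / 10)) s :=
    fun s hs => (hd s hs).snd
  have hp0 : p 0 = 0 := congrArg Prod.snd hi
  have hh0 : h 0 = a := congrArg Prod.fst hi
  have hpb : ∀ s ∈ Icc (-(11 / 10) : ℝ) (11 / 10), |p s| ≤ 11 := by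
    intro s hs
    have := (convex_Icc (-(11 / 10) : ℝ) (11 / 10)).norm_image_sub_le_of_norm_hasDerivWithin_le
      hdp (fun x _ => abs_cutoffForce_le (h x)) h0 hs
    rw [hp0, sub_zero, sub_zero, Real.norm_eq_abs, Real.norm_eq_abs] at this
    have h2 : |s| ≤ 11 / 10 := abs_le.2 hs
    linarith
  have hdh : ∀ s ∈ Icc (-(11 / 10) : ℝ) (11 / 10),
      HasDerivWithinAt h (p s) (Icc (-(11 / 10)) (11 / 10)) s := by
    intro s hs
    have h1 := (hd s hs).fst
    have h2 := abs_le.1 (hpb s hs)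
    rwa [min_eq_left h2.2, max_eq_right h2.1] at h1
  have hE : ∀ s ∈ Icc (-(11 / 10) : ℝ) (11 / 10),
      p s ^ 2 / 2 - cutoffPotential (h s) = - cutoffPotential a := by
    intro s hs
    have := eq_of_hasDerivAt_zero (a := -(11 / 10)) (b := 11 / 10)
      (f := fun s => p s ^ 2 / 2 - cutoffPotential (h s))
      (fun t ht => (((hdp t ht).continuousWithinAt.pow 2).div_const 2).sub
        ((hasDerivAt_cutoffPotential _).continuousAt.comp_continuousWithinAt
          (hdh t ht).continuousWithinAt))
      (fun t ht => by
        have hn := Icc_mem_nhds ht.1 ht.2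
        have h1 := (hdp t (Ioo_subset_Icc_self ht)).hasDerivAt hn
        have h2 := (hdh t (Ioo_subset_Icc_self ht)).hasDerivAt hn
        refine (((h1.pow 2).div_const 2).sub
          ((hasDerivAt_cutoffPotential (h t)).comp t h2)).congr_deriv ?_
        simp
        ring) hs h0
    simp only [hp0, hh0] at this
    rw [this]; norm_num
  intro s hs
  have hs' := Ioo_subset_Icc_self hs
  have hn := Icc_mem_nhds hs.1 hs.2
  -- The solution starts at rest, so its kinetic energy is the gain in potential, which is therefore
  -- nonnegative. This confines `h` to `[a, 3]`, where the force is unmodified.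
  have hge : cutoffPotential a ≤ cutoffPotential (h s) := by
    nlinarith [hE s hs', sq_nonneg (p s)]
  have ha1 : a ≤ h s := by
    by_contra! hlt
    exact (cutoffPotential_lt hlt ha.2).not_ge hge
  have ha2 : h s ≤ 3 := by
    by_contra! hlt
    have h1 := cutoffPotential_le (x := 3) (by norm_num) hlt.le
    have h2 : cutoffPotential (1 / 10) ≤ cutoffPotential a := by
      rcases eq_or_lt_of_le ha.1 with h3 | h3
      · rw [h3]
      · exact (cutoffPotential_lt h3 ha.2).le
    linarith [cutoffPotential_three_lt]
  refine ⟨(hdh s hs').hasDerivAt hn, ?_, ha1, ha2⟩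
  have := (hdp s hs').hasDerivAt hn
  rwa [cutoffForce_eq (ha.1.trans ha1) (by linarith)] at this

/-- There is a shrinking lens; its support function extends beyond the interval of normal
angles. -/
theorem exists_isLensProfile : ∃ h p : ℝ → ℝ, IsLensProfile h p ∧
    ∀ s ∈ Ioo (-(11 / 10) : ℝ) (11 / 10), 0 < h s ∧ HasDerivAt h (p s) s ∧
      HasDerivAt p ((h s)⁻¹ - h s) s := by
  obtain ⟨α, hα, hc⟩ := exists_support_flow
  have hπ := Real.pi_pos
  -- The margin beyond `π/3` provides two-sided derivatives at the end angles, and hence smoothness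
  -- of the arc up to its end points.
  have hπ' : Real.pi / 3 < 11 / 10 := by linarith [Real.pi_lt_d2]
  have hsub : Icc 0 (Real.pi / 3) ⊆ Ioo (-(11 / 10) : ℝ) (11 / 10) := fun s hs =>
    ⟨by linarith [hs.1], by linarith [hs.2]⟩
  have hsub' : angleInterval ⊆ Ioo (-(11 / 10) : ℝ) (11 / 10) := fun s hs =>
    ⟨by linarith [hs.1], by linarith [hs.2]⟩
  have hend : Real.pi / 3 ∈ Icc 0 (Real.pi / 3) := right_mem_Icc.2 (by positivity)
  have hheight : ∀ a ∈ Icc (1 / 10 : ℝ) 1, ∀ c : ℝ, ∀ s ∈ Icc 0 (Real.pi / 3),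
      HasDerivAt (fun s => (α a s).1 * Real.cos s - (α a s).2 * Real.sin s - c * Real.cos s)
        (Real.sin s * (c - (α a s).1⁻¹)) s := by
    intro a ha c s hs
    obtain ⟨h1, h2, -, -⟩ := (hα a ha).2 s (hsub hs)
    refine (((h1.mul (Real.hasDerivAt_cos s)).sub (h2.mul (Real.hasDerivAt_sin s))).sub
      ((Real.hasDerivAt_cos s).const_mul c)).congr_deriv ?_
    ring
  have hsin : ∀ s ∈ Icc 0 (Real.pi / 3), 0 ≤ Real.sin s := fun s hs =>
    Real.sin_nonneg_of_nonneg_of_le_pi hs.1 (by linarith [hs.2])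
  have hFc : ContinuousOn (fun a => (α a (Real.pi / 3)).1 * Real.cos (Real.pi / 3)
      - (α a (Real.pi / 3)).2 * Real.sin (Real.pi / 3)) (Icc (1 / 10) 1) :=
    ((hc _ (hsub hend)).fst.mul continuousOn_const).sub
      ((hc _ (hsub hend)).snd.mul continuousOn_const)
  -- For `a = 1` one has `h ≥ 1`, so height minus `cos` is nondecreasing and the height at `π/3` is
  -- at least `1/2`.
  have hF1 : 0 ≤ (α 1 (Real.pi / 3)).1 * Real.cos (Real.pi / 3)
      - (α 1 (Real.pi / 3)).2 * Real.sin (Real.pi / 3) := by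
    have h1 : (1 : ℝ) ∈ Icc (1 / 10 : ℝ) 1 := ⟨by norm_num, le_rfl⟩
    have := monotoneOn_Icc_of_hasDerivAt
      (fun s hs => (hheight 1 h1 1 s hs).continuousAt.continuousWithinAt)
      (fun s hs => hheight 1 h1 1 s (Ioo_subset_Icc_self hs))
      (fun s hs => mul_nonneg (hsin s (Ioo_subset_Icc_self hs)) (sub_nonneg.2
        (inv_le_one_of_one_le₀ ((hα 1 h1).2 s (hsub (Ioo_subset_Icc_self hs))).2.2.1)))
      (left_mem_Icc.2 (by positivity)) hend (by positivity)
    simp only [(hα 1 h1).1, Real.cos_zero, Real.sin_zero, Real.cos_pi_div_three] at this ⊢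
    linarith
  -- For `a = 1/10` the bound `h ≤ 3` makes height minus `cos / 3` nonincreasing, so the height at
  -- `π/3` is at most `1/10 - 1/3 + 1/6 < 0`.
  have hF0 : (α (1 / 10) (Real.pi / 3)).1 * Real.cos (Real.pi / 3)
      - (α (1 / 10) (Real.pi / 3)).2 * Real.sin (Real.pi / 3) ≤ 0 := by
    have h1 : (1 / 10 : ℝ) ∈ Icc (1 / 10 : ℝ) 1 := ⟨le_rfl, by norm_num⟩
    have := antitoneOn_Icc_of_hasDerivAt
      (fun s hs => (hheight _ h1 (1 / 3) s hs).continuousAt.continuousWithinAt)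
      (fun s hs => hheight _ h1 (1 / 3) s (Ioo_subset_Icc_self hs))
      (fun s hs => by
        obtain ⟨-, -, h2, h3⟩ := (hα _ h1).2 s (hsub (Ioo_subset_Icc_self hs))
        refine mul_nonpos_of_nonneg_of_nonpos (hsin s (Ioo_subset_Icc_self hs))
          (sub_nonpos.2 ?_)
        rw [one_div]
        exact inv_anti₀ (lt_of_lt_of_le (by norm_num) h2) h3)
      (left_mem_Icc.2 (by positivity)) hend (by positivity)
    simp only [(hα _ h1).1, Real.cos_zero, Real.sin_zero, Real.cos_pi_div_three] at this ⊢
    linarith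
  obtain ⟨a, ha, ha0⟩ := intermediate_value_Icc (by norm_num) hFc ⟨hF0, hF1⟩
  obtain ⟨hi, hode⟩ := hα a ha
  have ha' : 0 < a := lt_of_lt_of_le (by norm_num) ha.1
  obtain ⟨L, hL⟩ := lipschitzWith_supportField ha'
  -- Initial data `(a, 0)` are invariant under reflection, so the solution is even and the left
  -- boundary condition follows from the right one.
  have heven : EqOn (fun s => ((α a s).1, (α a s).2)) (fun s => ((α a (-s)).1, -(α a (-s)).2))
      (Ioo (-(11 / 10) : ℝ) (11 / 10)) := by
    refine ODE_solution_unique_of_mem_Ioo (t₀ := 0)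
      (v := fun _ => fun z : ℝ × ℝ => (z.2, (max z.1 a)⁻¹ - z.1)) (s := fun _ => univ)
      (fun t _ => hL.lipschitzOnWith) (by constructor <;> norm_num) (fun s hs => ?_)
      (fun s hs => ?_) (by simp [hi])
    · obtain ⟨h1, h2, h3, -⟩ := hode s hs
      rw [max_eq_left h3]
      exact ⟨h1.prodMk h2, mem_univ _⟩
    · obtain ⟨h1, h2, h3, -⟩ := hode (-s) ⟨by linarith [hs.2], by linarith [hs.1]⟩
      rw [max_eq_left h3]
      exact ⟨h1.comp_neg_real.prodMk (h2.comp_neg_real.neg.congr_deriv (neg_neg _)), mem_univ _⟩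
  have hright : (α a (Real.pi / 3)).1 = √3 * (α a (Real.pi / 3)).2 := by
    rw [Real.cos_pi_div_three, Real.sin_pi_div_three] at ha0
    linarith
  have hev := heven (hsub hend)
  have hev1 := congrArg Prod.fst hev
  have hev2 := congrArg Prod.snd hev
  simp only at hev1 hev2
  refine ⟨fun s => (α a s).1, fun s => (α a s).2,
    ⟨fun s hs => (hode s (hsub' hs)).1.continuousAt.continuousWithinAt,
      fun s hs => (hode s (hsub' hs)).2.1.continuousAt.continuousWithinAt,
      fun s hs => ha'.trans_le (hode s (hsub' hs)).2.2.1,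
      fun s hs => (hode s (hsub' (Ioo_subset_Icc_self hs))).1,
      fun s hs => (hode s (hsub' (Ioo_subset_Icc_self hs))).2.1, ?_, hright⟩,
    fun s hs => ⟨ha'.trans_le (hode s hs).2.2.1, (hode s hs).1, (hode s hs).2.1⟩⟩
  rw [← hev1, hright, hev2]
  ring

/-! ### Inverses of injective continuous maps on compact sets -/

/-- By compactness it suffices to identify the cluster points of `φ`; each is mapped by `f` to `f
x`, hence equals `x`. -/
theorem tendsto_of_injOn_of_isCompact {α β ι : Type*} [TopologicalSpace α] [TopologicalSpace β]
    [T2Space β] {K : Set α} (hK : IsCompact K) {f : α → β} (hf : ContinuousOn f K)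
    (hi : InjOn f K) {l : Filter ι} {φ : ι → α} (hφ : ∀ᶠ i in l, φ i ∈ K) {x : α} (hx : x ∈ K)
    (h : Tendsto (fun i => f (φ i)) l (𝓝 (f x))) : Tendsto φ l (𝓝 x) := by
  refine hK.le_nhds_of_unique_clusterPt (l := map φ l) hφ fun z hz hcl => hi hz hx ?_
  have hne : (𝓝 z ⊓ map φ l).NeBot := hcl
  have h1 : Tendsto f (𝓝 z ⊓ map φ l) (𝓝 (f z)) := by
    refine (hf z hz).mono_left (le_inf inf_le_left ?_)
    exact inf_le_right.trans (le_principal_iff.2 hφ)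
  have h2 : Tendsto f (𝓝 z ⊓ map φ l) (𝓝 (f x)) :=
    (tendsto_map'_iff.2 h).mono_left inf_le_right
  exact tendsto_nhds_unique h1 h2

theorem exists_continuous_inverse {f : ℝ → ℝ} {a b : ℝ} (hab : a ≤ b)
    (hf : ContinuousOn f (Icc a b)) (hm : StrictMonoOn f (Icc a b)) :
    ∃ g : ℝ → ℝ, MapsTo g (Icc (f a) (f b)) (Icc a b) ∧ (∀ y ∈ Icc (f a) (f b), f (g y) = y) ∧
      (∀ x ∈ Icc a b, g (f x) = x) ∧ ContinuousOn g (Icc (f a) (f b)) := by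
  have hs : SurjOn f (Icc a b) (Icc (f a) (f b)) := intermediate_value_Icc hab hf
  have h1 : MapsTo (Function.invFunOn f (Icc a b)) (Icc (f a) (f b)) (Icc a b) :=
    hs.mapsTo_invFunOn
  have h2 : ∀ y ∈ Icc (f a) (f b), f (Function.invFunOn f (Icc a b) y) = y :=
    fun y hy => hs.rightInvOn_invFunOn hy
  refine ⟨Function.invFunOn f (Icc a b), h1, h2, fun x hx => hm.injOn.leftInvOn_invFunOn hx, ?_⟩
  intro y hy
  refine tendsto_of_injOn_of_isCompact isCompact_Icc hf hm.injOn
    (eventually_mem_nhdsWithin.mono fun z hz => h1 hz) (h1 hy) ?_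
  rw [h2 y hy]
  refine (tendsto_id'.2 nhdsWithin_le_nhds : Tendsto id (𝓝[Icc (f a) (f b)] y) (𝓝 y)).congr' ?_
  exact eventually_mem_nhdsWithin.mono fun z hz => (h2 z hz).symm

/-! ### The support function of a shrinking arc -/

/-- The upper arc of a lens in coordinates, with first derivatives `a`, `b` and second derivatives
`a₂`, `b₂`, whose curvature vector is `μ` times the normal part of the position. -/
structure IsShrinkingArc (μ : ℝ) (X Y a b a₂ b₂ : ℝ → ℝ) : Prop where
  continuousOn_X : ContinuousOn X paramInterval
  continuousOn_Y : ContinuousOn Y paramInterval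
  continuousOn_a : ContinuousOn a paramInterval
  continuousOn_b : ContinuousOn b paramInterval
  deriv_X : ∀ x ∈ Ioo (-1 : ℝ) 1, HasDerivAt X (a x) x
  deriv_Y : ∀ x ∈ Ioo (-1 : ℝ) 1, HasDerivAt Y (b x) x
  deriv_a : ∀ x ∈ Ioo (-1 : ℝ) 1, HasDerivAt a (a₂ x) x
  deriv_b : ∀ x ∈ Ioo (-1 : ℝ) 1, HasDerivAt b (b₂ x) x
  regular : ∀ x ∈ paramInterval, 0 < a x ^ 2 + b x ^ 2
  curvature : ∀ x ∈ Ioo (-1 : ℝ) 1,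
    a x * b₂ x - b x * a₂ x = μ * (a x ^ 2 + b x ^ 2) * (a x * Y x - b x * X x)
  Y_left : Y (-1) = 0
  Y_right : Y 1 = 0
  Y_pos : ∀ x ∈ Ioo (-1 : ℝ) 1, 0 < Y x
  X_lt : X (-1) < X 1
  a_left : 0 < a (-1)
  b_left : b (-1) = √3 * a (-1)
  a_right : 0 < a 1
  b_right : b 1 = -(√3 * a 1)

namespace IsShrinkingArc

variable {μ : ℝ} {X Y a b a₂ b₂ : ℝ → ℝ}

theorem hasDerivAt_speed (H : IsShrinkingArc μ X Y a b a₂ b₂) {x : ℝ} (hx : x ∈ Ioo (-1 : ℝ) 1) :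
    HasDerivAt (fun x => √(a x ^ 2 + b x ^ 2))
      ((a x * a₂ x + b x * b₂ x) / √(a x ^ 2 + b x ^ 2)) x := by
  have hR := H.regular x (Ioo_subset_Icc_self hx)
  refine ((((H.deriv_a x hx).pow 2).add ((H.deriv_b x hx).pow 2)).sqrt hR.ne').congr_deriv ?_
  have := Real.sqrt_pos.2 hR
  simp only [Pi.add_apply, Pi.pow_apply]
  field_simp
  ring

theorem continuousOn_speed (H : IsShrinkingArc μ X Y a b a₂ b₂) :
    ContinuousOn (fun x => √(a x ^ 2 + b x ^ 2)) paramInterval :=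
  ((H.continuousOn_a.pow 2).add (H.continuousOn_b.pow 2)).sqrt

theorem speed_pos (H : IsShrinkingArc μ X Y a b a₂ b₂) {x : ℝ} (hx : x ∈ paramInterval) :
    0 < √(a x ^ 2 + b x ^ 2) := Real.sqrt_pos.2 (H.regular x hx)

theorem speed_mul_self (H : IsShrinkingArc μ X Y a b a₂ b₂) {x : ℝ} (hx : x ∈ paramInterval) :
    √(a x ^ 2 + b x ^ 2) * √(a x ^ 2 + b x ^ 2) = a x ^ 2 + b x ^ 2 :=
  Real.mul_self_sqrt (H.regular x hx).le

/-- The support function as a function of the parameter. -/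
theorem hasDerivAt_support (H : IsShrinkingArc μ X Y a b a₂ b₂) {x : ℝ}
    (hx : x ∈ Ioo (-1 : ℝ) 1) :
    HasDerivAt (fun x => (a x * Y x - b x * X x) / √(a x ^ 2 + b x ^ 2))
      (-μ * (a x * Y x - b x * X x) * ((a x * X x + b x * Y x) / √(a x ^ 2 + b x ^ 2))) x := by
  have hr := H.speed_pos (Ioo_subset_Icc_self hx)
  have hr2 := H.speed_mul_self (Ioo_subset_Icc_self hx)
  refine ((((H.deriv_a x hx).mul (H.deriv_Y x hx)).sub ((H.deriv_b x hx).mul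
    (H.deriv_X x hx))).div (H.hasDerivAt_speed hx) hr.ne').congr_deriv ?_
  have hc := H.curvature x hx
  simp only [Pi.mul_apply, Pi.sub_apply]
  generalize √(a x ^ 2 + b x ^ 2) = r at *
  field_simp
  linear_combination (a₂ x * Y x - b₂ x * X x + μ * (a x * Y x - b x * X x) *
    (a x * X x + b x * Y x)) * hr2 - (a x * X x + b x * Y x) * hc

/-- The tangential component of the position is the derivative of the support function with respect
to the normal angle, and becomes `p`. Together the two derivative formulas are the profile equation
before the change of parameter. -/
theorem hasDerivAt_tangential (H : IsShrinkingArc μ X Y a b a₂ b₂) {x : ℝ}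
    (hx : x ∈ Ioo (-1 : ℝ) 1) :
    HasDerivAt (fun x => (a x * X x + b x * Y x) / √(a x ^ 2 + b x ^ 2))
      (√(a x ^ 2 + b x ^ 2) + μ * (a x * Y x - b x * X x) *
        ((a x * Y x - b x * X x) / √(a x ^ 2 + b x ^ 2))) x := by
  have hr := H.speed_pos (Ioo_subset_Icc_self hx)
  have hr2 := H.speed_mul_self (Ioo_subset_Icc_self hx)
  refine ((((H.deriv_a x hx).mul (H.deriv_X x hx)).add ((H.deriv_b x hx).mul
    (H.deriv_Y x hx))).div (H.hasDerivAt_speed hx) hr.ne').congr_deriv ?_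
  have hc := H.curvature x hx
  simp only [Pi.mul_apply, Pi.add_apply]
  generalize √(a x ^ 2 + b x ^ 2) = r at *
  field_simp
  linear_combination (a₂ x * X x + b₂ x * Y x + a x ^ 2 + b x ^ 2 - r * r - (a x ^ 2 + b x ^ 2)
    - μ * (a x * Y x - b x * X x) ^ 2) * hr2 + (a x * Y x - b x * X x) * hc

theorem continuousOn_support (H : IsShrinkingArc μ X Y a b a₂ b₂) :
    ContinuousOn (fun x => (a x * Y x - b x * X x) / √(a x ^ 2 + b x ^ 2)) paramInterval :=
  ((H.continuousOn_a.mul H.continuousOn_Y).sub (H.continuousOn_b.mul H.continuousOn_X)).div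
    H.continuousOn_speed fun _ hx => (H.speed_pos hx).ne'

theorem continuousOn_tangential (H : IsShrinkingArc μ X Y a b a₂ b₂) :
    ContinuousOn (fun x => (a x * X x + b x * Y x) / √(a x ^ 2 + b x ^ 2)) paramInterval :=
  ((H.continuousOn_a.mul H.continuousOn_X).add (H.continuousOn_b.mul H.continuousOn_Y)).div
    H.continuousOn_speed fun _ hx => (H.speed_pos hx).ne'

/-- The support function is a constant multiple of `exp (-μ |c|² / 2)`. -/
theorem support_eq (H : IsShrinkingArc μ X Y a b a₂ b₂) {x y : ℝ} (hx : x ∈ paramInterval)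
    (hy : y ∈ paramInterval) :
    (a x * Y x - b x * X x) / √(a x ^ 2 + b x ^ 2) * Real.exp (μ / 2 * (X x ^ 2 + Y x ^ 2)) =
    (a y * Y y - b y * X y) / √(a y ^ 2 + b y ^ 2) * Real.exp (μ / 2 * (X y ^ 2 + Y y ^ 2)) := by
  refine eq_of_hasDerivAt_zero (f := fun x => (a x * Y x - b x * X x) / √(a x ^ 2 + b x ^ 2) *
    Real.exp (μ / 2 * (X x ^ 2 + Y x ^ 2))) ?_ ?_ hx hy
  · exact H.continuousOn_support.mul (continuousOn_const.mul
      ((H.continuousOn_X.pow 2).add (H.continuousOn_Y.pow 2))).rexp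
  · intro z hz
    refine ((H.hasDerivAt_support hz).mul (((((H.deriv_X z hz).pow 2).add
      ((H.deriv_Y z hz).pow 2)).const_mul (μ / 2)).exp)).congr_deriv ?_
    simp only [Pi.add_apply, Pi.pow_apply]
    ring

/-- By `support_eq` the support function has a constant sign. If it were not positive, the end
angles would give `X (-1) ≥ 0 ≥ X 1`, against the order of the end points. -/
theorem support_pos (H : IsShrinkingArc μ X Y a b a₂ b₂) {x : ℝ} (hx : x ∈ paramInterval) :
    0 < a x * Y x - b x * X x := by
  have hl : (-1 : ℝ) ∈ paramInterval := by constructor <;> norm_num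
  have hr : (1 : ℝ) ∈ paramInterval := by constructor <;> norm_num
  have h3 : 0 < √3 := by positivity
  have hsign : ∀ z ∈ paramInterval, (0 < (a z * Y z - b z * X z) / √(a z ^ 2 + b z ^ 2) *
      Real.exp (μ / 2 * (X z ^ 2 + Y z ^ 2)) ↔ 0 < a z * Y z - b z * X z) := fun z hz => by
    rw [mul_pos_iff_of_pos_right (Real.exp_pos _), div_pos_iff_of_pos_right (H.speed_pos hz)]
  rw [← hsign x hx]
  by_contra hle
  have h1 : ¬ 0 < a (-1) * Y (-1) - b (-1) * X (-1) := by
    rw [← hsign _ hl, H.support_eq hl hx]; exact hle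
  have h2 : ¬ 0 < a 1 * Y 1 - b 1 * X 1 := by
    rw [← hsign _ hr, H.support_eq hr hx]; exact hle
  rw [H.Y_left, H.b_left] at h1
  rw [H.Y_right, H.b_right] at h2
  have h4 : 0 ≤ (√3 * a (-1)) * X (-1) := by linarith
  have h5 : (√3 * a 1) * X 1 ≤ 0 := by linarith
  have h6 := nonneg_of_mul_nonneg_right h4 (mul_pos h3 H.a_left)
  have h7 := nonpos_of_mul_nonpos_right h5 (mul_pos h3 H.a_right)
  linarith [H.X_lt]

/-- The arc is star-shaped about the origin: the derivative of `X / Y` is the positive quantity of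
`support_pos` divided by `Y²`. -/
theorem cot_le (H : IsShrinkingArc μ X Y a b a₂ b₂) {x y : ℝ} (hx : x ∈ Ioo (-1 : ℝ) 1)
    (hy : y ∈ Ioo (-1 : ℝ) 1) (hxy : x ≤ y) : X x / Y x ≤ X y / Y y := by
  have hsub : ∀ z ∈ Icc x y, z ∈ Ioo (-1 : ℝ) 1 := fun z hz =>
    ⟨hx.1.trans_le hz.1, hz.2.trans_lt hy.2⟩
  have hd : ∀ z ∈ Icc x y, HasDerivAt (fun z => X z / Y z)
      ((a z * Y z - X z * b z) / Y z ^ 2) z := fun z hz =>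
    (H.deriv_X z (hsub z hz)).div (H.deriv_Y z (hsub z hz)) (H.Y_pos z (hsub z hz)).ne'
  refine monotoneOn_Icc_of_hasDerivAt (fun z hz => (hd z hz).continuousAt.continuousWithinAt)
    (fun z hz => hd z (Ioo_subset_Icc_self hz)) (fun z hz => ?_) (left_mem_Icc.2 hxy)
    (right_mem_Icc.2 hxy) hxy
  have := H.support_pos (Ioo_subset_Icc_self (hsub z (Ioo_subset_Icc_self hz)))
  refine div_nonneg ?_ (sq_nonneg _)
  linarith

/-- At a vertical tangent, the first coordinate of the acceleration has the sign of `b`, and that of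
the position the opposite sign. -/
theorem vertical (H : IsShrinkingArc μ X Y a b a₂ b₂) (hμ₀ : μ < 0) {x : ℝ} (hx : x ∈ Ioo (-1 : ℝ) 1)
    (h0 : a x = 0) : (a₂ x ≤ 0 → 0 < X x) ∧ (0 ≤ a₂ x → X x < 0) := by
  have hP := H.support_pos (Ioo_subset_Icc_self hx)
  have hR := H.regular x (Ioo_subset_Icc_self hx)
  have hc := H.curvature x hx
  rw [h0] at hP hR hc
  have hb : b x ≠ 0 := by rintro hb; rw [hb] at hR; norm_num at hR
  have ha2 : a₂ x = (-μ * b x) * -(b x * X x) := by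
    have : b x * a₂ x = b x * ((-μ * b x) * -(b x * X x)) := by linear_combination -hc
    exact mul_left_cancel₀ hb this
  have hbX : 0 < -(b x * X x) := by linarith
  have hμ : 0 < -μ := by linarith
  constructor
  · intro h
    rw [ha2] at h
    have h1 := nonpos_of_mul_nonpos_left h hbX
    have h2 : b x ≤ 0 := nonpos_of_mul_nonpos_right h1 hμ
    have h3 : b x < 0 := lt_of_le_of_ne h2 hb
    by_contra! h4
    nlinarith
  · intro h
    rw [ha2] at h
    have h1 := nonneg_of_mul_nonneg_left h hbX
    have h2 : 0 ≤ b x := nonneg_of_mul_nonneg_right h1 hμ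
    have h3 : 0 < b x := lt_of_le_of_ne h2 hb.symm
    by_contra! h4
    nlinarith

end IsShrinkingArc

theorem HasDerivAt.nonpos_of_left {f : ℝ → ℝ} {f' x : ℝ} (hf : HasDerivAt f f' x)
    (h : ∀ᶠ y in 𝓝[<] x, f x ≤ f y) : f' ≤ 0 := by
  have h1 := (hasDerivWithinAt_iff_tendsto_slope' (self_notMem_Iio (a := x))).1
    (hf.hasDerivWithinAt (s := Iio x))
  refine le_of_tendsto h1 ?_
  filter_upwards [h, self_mem_nhdsWithin] with y hy hyx
  rw [slope_def_field]
  exact div_nonpos_of_nonneg_of_nonpos (by linarith) (by linarith [mem_Iio.1 hyx])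

theorem HasDerivAt.nonneg_of_right {f : ℝ → ℝ} {f' x : ℝ} (hf : HasDerivAt f f' x)
    (h : ∀ᶠ y in 𝓝[>] x, f x ≤ f y) : 0 ≤ f' := by
  have h1 := (hasDerivWithinAt_iff_tendsto_slope' (self_notMem_Ioi (a := x))).1
    (hf.hasDerivWithinAt (s := Ioi x))
  refine ge_of_tendsto h1 ?_
  filter_upwards [h, self_mem_nhdsWithin] with y hy hyx
  rw [slope_def_field]
  exact div_nonneg (by linarith) (by linarith [mem_Ioi.1 hyx])

namespace IsShrinkingArc

variable {μ : ℝ} {X Y a b a₂ b₂ : ℝ → ℝ}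

/-- A shrinking arc is a graph over the `x¹`-axis. -/
theorem a_pos (H : IsShrinkingArc μ X Y a b a₂ b₂) (hμ₀ : μ < 0) : ∀ x ∈ paramInterval, 0 < a x := by
  by_contra! hne
  obtain ⟨x₀, hx₀, hax₀⟩ := hne
  have hK : IsCompact {x ∈ paramInterval | a x ≤ 0} := by
    refine isCompact_Icc.of_isClosed_subset ?_ (fun x hx => hx.1)
    exact H.continuousOn_a.preimage_isClosed_of_isClosed isClosed_Icc isClosed_Iic
  have hin : ∀ x ∈ {x ∈ paramInterval | a x ≤ 0}, x ∈ Ioo (-1 : ℝ) 1 := by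
    rintro x ⟨hx, hax⟩
    refine ⟨lt_of_le_of_ne hx.1 ?_, lt_of_le_of_ne hx.2 ?_⟩
    · rintro rfl; linarith [H.a_left]
    · rintro rfl; linarith [H.a_right]
  -- At the first point with `a ≤ 0` the tangent is vertical and `a₂ ≤ 0`, so `X > 0`; at the last
  -- one `a₂ ≥ 0`, so `X < 0`. This contradicts the monotonicity of `X / Y`.
  obtain ⟨x, hxK, hxl⟩ := hK.exists_isLeast ⟨x₀, hx₀, hax₀⟩
  obtain ⟨y, hyK, hyg⟩ := hK.exists_isGreatest ⟨x₀, hx₀, hax₀⟩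
  have hx := hin x hxK
  have hy := hin y hyK
  have hleft : ∀ᶠ z in 𝓝[<] x, 0 < a z := by
    filter_upwards [Ioo_mem_nhdsLT hx.1] with z hz
    by_contra! h
    exact hz.2.not_ge (hxl ⟨⟨hz.1.le, hz.2.le.trans hx.2.le⟩, h⟩)
  have hright : ∀ᶠ z in 𝓝[>] y, 0 < a z := by
    filter_upwards [Ioo_mem_nhdsGT hy.2] with z hz
    by_contra! h
    exact hz.1.not_ge (hyg ⟨⟨hy.1.le.trans hz.1.le, hz.2.le⟩, h⟩)
  have hx0 : a x = 0 := le_antisymm hxK.2 (ge_of_tendsto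
    ((H.deriv_a x hx).continuousAt.tendsto.mono_left nhdsWithin_le_nhds)
    (hleft.mono fun z hz => hz.le))
  have hy0 : a y = 0 := le_antisymm hyK.2 (ge_of_tendsto
    ((H.deriv_a y hy).continuousAt.tendsto.mono_left nhdsWithin_le_nhds)
    (hright.mono fun z hz => hz.le))
  have hXx := (H.vertical hμ₀ hx hx0).1
    ((H.deriv_a x hx).nonpos_of_left (hleft.mono fun z hz => hx0.trans_le hz.le))
  have hXy := (H.vertical hμ₀ hy hy0).2
    ((H.deriv_a y hy).nonneg_of_right (hright.mono fun z hz => hy0.trans_le hz.le))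
  have h1 := H.cot_le hx hy (hxl hyK)
  have h2 := div_pos hXx (H.Y_pos x hx)
  have h3 := div_neg_of_neg_of_pos hXy (H.Y_pos y hy)
  linarith

/-- The normal `(-b, a)` makes this angle with the `x²`-axis. Its derivative is minus the signed
curvature times the speed, and the shrinker equation expresses it by the support function, so the
angle is strictly increasing. -/
theorem hasDerivAt_angle (H : IsShrinkingArc μ X Y a b a₂ b₂) (hμ₀ : μ < 0) {x : ℝ}
    (hx : x ∈ Ioo (-1 : ℝ) 1) :
    HasDerivAt (fun x => Real.arctan (-b x / a x)) (-μ * (a x * Y x - b x * X x)) x := by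
  have ha := H.a_pos hμ₀ x (Ioo_subset_Icc_self hx)
  have hR := H.regular x (Ioo_subset_Icc_self hx)
  refine (((H.deriv_b x hx).neg.div (H.deriv_a x hx) ha.ne').arctan).congr_deriv ?_
  have hc := H.curvature x hx
  simp only [Pi.div_apply, Pi.neg_apply]
  have h1 : 1 + (-b x / a x) ^ 2 = (a x ^ 2 + b x ^ 2) / a x ^ 2 := by field_simp
  rw [h1]
  field_simp
  linear_combination -hc

theorem cos_angle (H : IsShrinkingArc μ X Y a b a₂ b₂) (hμ₀ : μ < 0) {x : ℝ} (hx : x ∈ paramInterval) :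
    Real.cos (Real.arctan (-b x / a x)) = a x / √(a x ^ 2 + b x ^ 2) := by
  have ha := H.a_pos hμ₀ x hx
  have h1 : 1 + (-b x / a x) ^ 2 = (a x ^ 2 + b x ^ 2) / a x ^ 2 := by field_simp
  rw [Real.cos_arctan, h1, Real.sqrt_div (H.regular x hx).le, Real.sqrt_sq ha.le, one_div_div]

theorem sin_angle (H : IsShrinkingArc μ X Y a b a₂ b₂) (hμ₀ : μ < 0) {x : ℝ} (hx : x ∈ paramInterval) :
    Real.sin (Real.arctan (-b x / a x)) = -b x / √(a x ^ 2 + b x ^ 2) := by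
  have ha := H.a_pos hμ₀ x hx
  have hr := H.speed_pos hx
  have h1 : 1 + (-b x / a x) ^ 2 = (a x ^ 2 + b x ^ 2) / a x ^ 2 := by field_simp
  rw [Real.sin_arctan, h1, Real.sqrt_div (H.regular x hx).le, Real.sqrt_sq ha.le]
  field_simp

/-- After rescaling, a shrinking arc is parametrised by the angle of its normal through its support
function, which is a lens profile. -/
theorem exists_profile (H : IsShrinkingArc μ X Y a b a₂ b₂) (hμ₀ : μ < 0) :
    ∃ h p g : ℝ → ℝ, IsLensProfile h p ∧ MapsTo g angleInterval paramInterval ∧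
      SurjOn g angleInterval paramInterval ∧ g (-(Real.pi / 3)) = -1 ∧ g (Real.pi / 3) = 1 ∧
      ∀ s ∈ angleInterval, √(-μ) * X (g s) = h s * Real.sin s + p s * Real.cos s ∧
        √(-μ) * Y (g s) = h s * Real.cos s - p s * Real.sin s := by
  have hl : (-1 : ℝ) ∈ paramInterval := by constructor <;> norm_num
  have hr : (1 : ℝ) ∈ paramInterval := by constructor <;> norm_num
  have hμ : 0 < -μ := by linarith
  set κ := √(-μ)
  have hκ : 0 < κ := Real.sqrt_pos.2 hμ
  have hκ2 : κ * κ = -μ := Real.mul_self_sqrt hμ.le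
  set ψ : ℝ → ℝ := fun x => Real.arctan (-b x / a x) with hψ
  have hψc : ContinuousOn ψ paramInterval :=
    Real.continuous_arctan.comp_continuousOn
      (H.continuousOn_b.neg.div H.continuousOn_a fun x hx => (H.a_pos hμ₀ x hx).ne')
  have hψ' : ∀ x ∈ Ioo (-1 : ℝ) 1, 0 < -μ * (a x * Y x - b x * X x) := fun x hx =>
    mul_pos hμ (H.support_pos (Ioo_subset_Icc_self hx))
  have hψm : StrictMonoOn ψ paramInterval :=
    strictMonoOn_Icc_of_hasDerivAt hψc (fun x hx => H.hasDerivAt_angle hμ₀ hx) hψ'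
  have hψl : ψ (-1) = -(Real.pi / 3) := by
    have h1 : -b (-1) / a (-1) = -√3 := by
      rw [H.b_left]; field_simp [H.a_left.ne']
    simp only [hψ]
    rw [h1, Real.arctan_neg, Real.arctan_sqrt_three]
  have hψr : ψ 1 = Real.pi / 3 := by
    have h1 : -b 1 / a 1 = √3 := by
      rw [H.b_right]; field_simp [H.a_right.ne']
    simp only [hψ]
    rw [h1, Real.arctan_sqrt_three]
  obtain ⟨g, hg, hψg, hgψ, hgc⟩ := exists_continuous_inverse (by norm_num) hψc hψm
  rw [hψl, hψr] at hg hψg hgc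
  have hgl : g (-(Real.pi / 3)) = -1 := by rw [← hψl]; exact hgψ _ hl
  have hgr : g (Real.pi / 3) = 1 := by rw [← hψr]; exact hgψ _ hr
  have hgo : ∀ s ∈ Ioo (-(Real.pi / 3)) (Real.pi / 3), g s ∈ Ioo (-1 : ℝ) 1 := by
    intro s hs
    have h1 := hg (Ioo_subset_Icc_self hs)
    have h2 := hψg s (Ioo_subset_Icc_self hs)
    refine ⟨lt_of_le_of_ne h1.1 fun h => ?_, lt_of_le_of_ne h1.2 fun h => ?_⟩
    · rw [← h, hψl] at h2; linarith [hs.1]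
    · rw [h, hψr] at h2; linarith [hs.2]
  have hgd : ∀ s ∈ Ioo (-(Real.pi / 3)) (Real.pi / 3),
      HasDerivAt g (-μ * (a (g s) * Y (g s) - b (g s) * X (g s)))⁻¹ s := by
    intro s hs
    have hn := Icc_mem_nhds hs.1 hs.2
    exact (H.hasDerivAt_angle hμ₀ (hgo s hs)).of_local_left_inverse (hgc.continuousAt hn)
      (hψ' _ (hgo s hs)).ne' (Filter.mem_of_superset hn fun y hy => hψg y hy)
  refine ⟨fun s => κ * ((a (g s) * Y (g s) - b (g s) * X (g s)) / √(a (g s) ^ 2 + b (g s) ^ 2)),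
    fun s => κ * ((a (g s) * X (g s) + b (g s) * Y (g s)) / √(a (g s) ^ 2 + b (g s) ^ 2)), g,
    ⟨continuousOn_const.mul (H.continuousOn_support.comp hgc hg),
      continuousOn_const.mul (H.continuousOn_tangential.comp hgc hg), fun s hs => ?_,
      fun s hs => ?_, fun s hs => ?_, ?_, ?_⟩, hg, fun x hx => ?_, hgl, hgr, fun s hs => ?_⟩
  · exact mul_pos hκ (div_pos (H.support_pos (hg hs)) (H.speed_pos (hg hs)))
  · refine (((H.hasDerivAt_support (hgo s hs)).comp s (hgd s hs)).const_mul κ).congr_deriv ?_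
    have hP := (H.support_pos (Ioo_subset_Icc_self (hgo s hs))).ne'
    have hμ' : μ ≠ 0 := hμ₀.ne
    generalize a (g s) * Y (g s) - b (g s) * X (g s) = P at *
    field_simp
  · refine (((H.hasDerivAt_tangential (hgo s hs)).comp s (hgd s hs)).const_mul κ).congr_deriv ?_
    have hP := (H.support_pos (Ioo_subset_Icc_self (hgo s hs))).ne'
    have hr := H.speed_pos (Ioo_subset_Icc_self (hgo s hs))
    have hμ' : μ ≠ 0 := hμ₀.ne
    generalize √(a (g s) ^ 2 + b (g s) ^ 2) = r at *
    generalize a (g s) * Y (g s) - b (g s) * X (g s) = P at *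
    field_simp
    linear_combination (-r ^ 2 - μ * P ^ 2) * hκ2 + μ * P ^ 2 * hκ2
  · simp only [hgl, H.Y_left, H.b_left]
    ring
  · simp only [hgr, H.Y_right, H.b_right]
    ring
  · refine ⟨ψ x, ⟨?_, ?_⟩, hgψ x hx⟩
    · rw [← hψl]
      exact hψm.monotoneOn hl hx hx.1
    · rw [← hψr]
      exact hψm.monotoneOn hx hr hx.2
  · have e1 := H.cos_angle hμ₀ (hg hs)
    have e2 := H.sin_angle hμ₀ (hg hs)
    have e3 := hψg s hs
    simp only [hψ] at e3
    rw [e3] at e1 e2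
    have hr := H.speed_pos (hg hs)
    have hr2 := H.speed_mul_self (hg hs)
    rw [e1, e2]
    beta_reduce
    generalize √(a (g s) ^ 2 + b (g s) ^ 2) = r at *
    constructor
    · field_simp
      linear_combination X (g s) * hr2
    · field_simp
      linear_combination Y (g s) * hr2

end IsShrinkingArc

/-! ### Plane vectors in coordinates -/

theorem Plane.ext_coord {p q : Plane} (h0 : p 0 = q 0) (h1 : p 1 = q 1) : p = q := by
  ext i
  fin_cases i
  · exact h0
  · exact h1

theorem Plane.inner_eq (p q : Plane) : inner ℝ p q = p 0 * q 0 + p 1 * q 1 := by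
  simp [PiLp.inner_apply, Fin.sum_univ_two]; ring

theorem Plane.norm_sq_eq (p : Plane) : ‖p‖ ^ 2 = p 0 ^ 2 + p 1 ^ 2 := by
  simp [EuclideanSpace.norm_sq_eq, Fin.sum_univ_two]

theorem Plane.norm_eq (p : Plane) : ‖p‖ = √(p 0 ^ 2 + p 1 ^ 2) := by
  rw [← Plane.norm_sq_eq, Real.sqrt_sq (norm_nonneg p)]

theorem HasDerivWithinAt.plane_coord {c : ℝ → Plane} {c' : Plane} {s : Set ℝ} {x : ℝ}
    (h : HasDerivWithinAt c c' s x) (i : Fin 2) :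
    HasDerivWithinAt (fun x => c x i) (c' i) s x :=
  (EuclideanSpace.proj (𝕜 := ℝ) i : Plane →L[ℝ] ℝ).hasFDerivAt.comp_hasDerivWithinAt x h

theorem HasDerivAt.plane_coord {c : ℝ → Plane} {c' : Plane} {x : ℝ}
    (h : HasDerivAt c c' x) (i : Fin 2) : HasDerivAt (fun x => c x i) (c' i) x :=
  (EuclideanSpace.proj (𝕜 := ℝ) i : Plane →L[ℝ] ℝ).hasFDerivAt.comp_hasDerivAt x h

theorem ContinuousOn.plane_coord {α : Type*} [TopologicalSpace α] {c : α → Plane} {s : Set α}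
    (h : ContinuousOn c s) (i : Fin 2) : ContinuousOn (fun x => c x i) s :=
  (EuclideanSpace.proj (𝕜 := ℝ) i : Plane →L[ℝ] ℝ).continuous.comp_continuousOn h

theorem HasDerivAt.plane_mk {f g : ℝ → ℝ} {f' g' x : ℝ} (hf : HasDerivAt f f' x)
    (hg : HasDerivAt g g' x) : HasDerivAt (fun x => (!₂[f x, g x] : Plane)) !₂[f', g'] x := by
  have h : HasDerivAt (fun x => ![f x, g x]) ![f', g'] x := by
    rw [hasDerivAt_pi]
    intro i
    fin_cases i
    · exact hf
    · exact hg
  exact ((EuclideanSpace.equiv (Fin 2) ℝ).symm :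
    (Fin 2 → ℝ) →L[ℝ] Plane).hasFDerivAt.comp_hasDerivAt x h

theorem neg_one_mem_paramInterval : (-1 : ℝ) ∈ paramInterval := by constructor <;> norm_num

theorem one_mem_paramInterval : (1 : ℝ) ∈ paramInterval := by constructor <;> norm_num

/-! ### Derivatives of lens arcs -/

namespace IsLensArc

variable {c d : ℝ → Plane}

theorem contDiffOn_deriv (H : IsLensArc c) : ContDiffOn ℝ ∞ (curveDeriv c) paramInterval :=
  H.smooth.derivWithin (uniqueDiffOn_Icc (by norm_num)) (by simp)

theorem contDiffOn_deriv2 (H : IsLensArc c) : ContDiffOn ℝ ∞ (curveDeriv2 c) paramInterval :=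
  H.contDiffOn_deriv.derivWithin (uniqueDiffOn_Icc (by norm_num)) (by simp)

theorem hasDerivWithinAt (H : IsLensArc c) {x : ℝ} (hx : x ∈ paramInterval) :
    HasDerivWithinAt c (curveDeriv c x) paramInterval x :=
  (H.smooth.differentiableOn (by simp) x hx).hasDerivWithinAt

theorem hasDerivWithinAt_deriv (H : IsLensArc c) {x : ℝ} (hx : x ∈ paramInterval) :
    HasDerivWithinAt (curveDeriv c) (curveDeriv2 c x) paramInterval x :=
  (H.contDiffOn_deriv.differentiableOn (by simp) x hx).hasDerivWithinAt

theorem hasDerivAt (H : IsLensArc c) {x : ℝ} (hx : x ∈ Ioo (-1 : ℝ) 1) :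
    HasDerivAt c (curveDeriv c x) x :=
  (H.hasDerivWithinAt (Ioo_subset_Icc_self hx)).hasDerivAt (Icc_mem_nhds hx.1 hx.2)

theorem hasDerivAt_deriv (H : IsLensArc c) {x : ℝ} (hx : x ∈ Ioo (-1 : ℝ) 1) :
    HasDerivAt (curveDeriv c) (curveDeriv2 c x) x :=
  (H.hasDerivWithinAt_deriv (Ioo_subset_Icc_self hx)).hasDerivAt (Icc_mem_nhds hx.1 hx.2)

theorem deriv_left (H : IsLensArc c) : 0 < curveDeriv c (-1) 0 ∧
    curveDeriv c (-1) 1 = √3 * curveDeriv c (-1) 0 := by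
  have hn : 0 < ‖curveDeriv c (-1)‖ := norm_pos_iff.2 (H.regular _ neg_one_mem_paramInterval)
  have h0 : ‖curveDeriv c (-1)‖⁻¹ * curveDeriv c (-1) 0 = 1 / 2 := by
    simpa using congrArg (fun p : Plane => p 0) H.angle_left
  have h1 : ‖curveDeriv c (-1)‖⁻¹ * curveDeriv c (-1) 1 = √3 / 2 := by
    simpa using congrArg (fun p : Plane => p 1) H.angle_left
  rw [inv_mul_eq_iff_eq_mul₀ hn.ne'] at h0 h1
  rw [h0, h1]
  exact ⟨by positivity, by ring⟩

theorem deriv_right (H : IsLensArc c) : 0 < curveDeriv c 1 0 ∧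
    curveDeriv c 1 1 = -(√3 * curveDeriv c 1 0) := by
  have hn : 0 < ‖curveDeriv c 1‖ := norm_pos_iff.2 (H.regular _ one_mem_paramInterval)
  have h0 : ‖curveDeriv c 1‖⁻¹ * curveDeriv c 1 0 = 1 / 2 := by
    simpa using congrArg (fun p : Plane => p 0) H.angle_right
  have h1 : ‖curveDeriv c 1‖⁻¹ * curveDeriv c 1 1 = -(√3 / 2) := by
    simpa using congrArg (fun p : Plane => p 1) H.angle_right
  rw [inv_mul_eq_iff_eq_mul₀ hn.ne'] at h0 h1
  rw [h0, h1]
  exact ⟨by positivity, by ring⟩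

theorem curveDeriv_smul (H : IsLensArc c) (k : ℝ) {x : ℝ} (hx : x ∈ paramInterval) :
    curveDeriv (fun y => k • c y) x = k • curveDeriv c x :=
  derivWithin_fun_const_smul k (H.hasDerivWithinAt hx).differentiableWithinAt

theorem curveDeriv2_smul (H : IsLensArc c) (k : ℝ) {x : ℝ} (hx : x ∈ paramInterval) :
    curveDeriv2 (fun y => k • c y) x = k • curveDeriv2 c x := by
  have : curveDeriv2 (fun y => k • c y) x
      = derivWithin (fun y => k • curveDeriv c y) paramInterval x :=
    derivWithin_congr (fun y hy => H.curveDeriv_smul k hy) (H.curveDeriv_smul k hx)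
  rw [this]
  exact derivWithin_fun_const_smul k (H.hasDerivWithinAt_deriv hx).differentiableWithinAt

theorem smul (H : IsLensArc c) {k : ℝ} (hk : 0 < k) : IsLensArc (fun x => k • c x) where
  smooth := H.smooth.const_smul k
  regular x hx := by
    rw [H.curveDeriv_smul k hx]
    exact smul_ne_zero hk.ne' (H.regular x hx)
  embedded := fun x hx y hy h => H.embedded hx hy (smul_right_injective Plane hk.ne' h)
  upper x hx := by simpa using mul_pos hk (H.upper x hx)
  left_mem_axis := by
    have : c (-1) 1 = 0 := H.left_mem_axis
    show k * c (-1) 1 = 0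
    rw [this, mul_zero]
  right_mem_axis := by
    have : c 1 1 = 0 := H.right_mem_axis
    show k * c 1 1 = 0
    rw [this, mul_zero]
  left_lt_right := by simpa using mul_lt_mul_of_pos_left H.left_lt_right hk
  angle_left := by
    rw [H.curveDeriv_smul k neg_one_mem_paramInterval, norm_smul, Real.norm_of_nonneg hk.le,
      smul_smul, mul_inv, mul_right_comm, inv_mul_cancel₀ hk.ne', one_mul, H.angle_left]
  angle_right := by
    rw [H.curveDeriv_smul k one_mem_paramInterval, norm_smul, Real.norm_of_nonneg hk.le,
      smul_smul, mul_inv, mul_right_comm, inv_mul_cancel₀ hk.ne', one_mul, H.angle_right]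

end IsLensArc

/-! ### Lens networks as sets -/

theorem homothety_zero_image (r : ℝ) (S : Set Plane) :
    AffineMap.homothety (0 : Plane) r '' S = (fun p => r • p) '' S := by
  refine image_congr fun p _ => ?_
  simp [AffineMap.homothety_apply]

theorem image_smul_lensNetwork {r : ℝ} (hr : 0 < r) (c : ℝ → Plane) :
    (fun p : Plane => r • p) '' lensNetwork c = lensNetwork (fun x => r • c x) := by
  have h1 : ∀ p : Plane, r • reflectX1 p = reflectX1 (r • p) := fun p =>
    Plane.ext_coord (by simp [reflectX1]) (by simp [reflectX1])
  have hinv : ∀ p : Plane, r • r⁻¹ • p = p := fun p => smul_inv_smul₀ hr.ne' p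
  simp only [lensNetwork, image_union, image_image]
  congr 1
  · congr 1
    · congr 1
      exact image_congr fun x _ => h1 (c x)
    · ext p
      simp only [mem_image, mem_ofPred_eq]
      constructor
      · rintro ⟨q, ⟨h2, h3⟩, rfl⟩
        simp [h2, hr, h3]
      · rintro ⟨h2, h3⟩
        refine ⟨r⁻¹ • p, ⟨by simp [h2], ?_⟩, hinv p⟩
        have : r⁻¹ * p 0 ≤ c (-1) 0 := (inv_mul_le_iff₀ hr).2 (by simpa using h3)
        simpa using this
  · ext p
    simp only [mem_image, mem_ofPred_eq]
    constructor
    · rintro ⟨q, ⟨h2, h3⟩, rfl⟩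
      simp [h2, hr, h3]
    · rintro ⟨h2, h3⟩
      refine ⟨r⁻¹ • p, ⟨by simp [h2], ?_⟩, hinv p⟩
      have : c 1 0 ≤ r⁻¹ * p 0 := (le_inv_mul_iff₀ hr).2 (by simpa using h3)
      simpa using this

/-! ### Recovering the upper arc from the network -/

namespace IsLensArc

variable {c d : ℝ → Plane}

theorem nonneg (H : IsLensArc c) {x : ℝ} (hx : x ∈ paramInterval) : 0 ≤ c x 1 := by
  have hl : c (-1) 1 = 0 := H.left_mem_axis
  have hr : c 1 1 = 0 := H.right_mem_axis
  rcases eq_or_lt_of_le hx.1 with h | h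
  · rw [← h, hl]
  · rcases eq_or_lt_of_le hx.2 with h' | h'
    · rw [h', hr]
    · exact (H.upper x ⟨h, h'⟩).le

theorem lensNetwork_inter_upper (H : IsLensArc c) :
    lensNetwork c ∩ {p | 0 < p 1} = c '' Ioo (-1) 1 := by
  have hl : c (-1) 1 = 0 := H.left_mem_axis
  have hr : c 1 1 = 0 := H.right_mem_axis
  ext p
  constructor
  · rintro ⟨((⟨x, hx, rfl⟩ | ⟨_, ⟨x, hx, rfl⟩, rfl⟩) | ⟨h, -⟩) | ⟨h, -⟩, hp⟩
    · refine ⟨x, ⟨lt_of_le_of_ne hx.1 ?_, lt_of_le_of_ne hx.2 ?_⟩, rfl⟩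
      · rintro rfl; exact hp.ne' hl
      · rintro rfl; exact hp.ne' hr
    · have h1 : 0 < -c x 1 := hp
      linarith [H.nonneg hx]
    · exact (hp.ne' h).elim
    · exact (hp.ne' h).elim
  · rintro ⟨x, hx, rfl⟩
    exact ⟨Or.inl (Or.inl (Or.inl ⟨x, Ioo_subset_Icc_self hx, rfl⟩)), H.upper x hx⟩

/-- The open upper half-plane sees only the open arc, and closing up adds the end points. Thus the
network determines the trace of its arc, though not the parametrisation. -/
theorem image_eq_closure (H : IsLensArc c) :
    c '' paramInterval = closure (lensNetwork c ∩ {p | 0 < p 1}) := by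
  have hcl : closure (Ioo (-1 : ℝ) 1) = paramInterval := closure_Ioo (by norm_num)
  rw [H.lensNetwork_inter_upper]
  apply Subset.antisymm
  · rw [← hcl]
    exact ContinuousOn.image_closure (by rw [hcl]; exact H.smooth.continuousOn)
  · exact closure_minimal (image_mono Ioo_subset_Icc_self)
      (isCompact_Icc.image_of_continuousOn H.smooth.continuousOn).isClosed

theorem image_eq_of_network_eq (H : IsLensArc c) (K : IsLensArc d)
    (h : lensNetwork c = lensNetwork d) : c '' paramInterval = d '' paramInterval := by
  rw [H.image_eq_closure, K.image_eq_closure, h]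

theorem eq_end_of_mem_axis (H : IsLensArc c) {x : ℝ} (hx : x ∈ paramInterval) (h : c x 1 = 0) :
    x = -1 ∨ x = 1 := by
  by_contra! hne
  exact (H.upper x ⟨lt_of_le_of_ne hx.1 hne.1.symm, lt_of_le_of_ne hx.2 hne.2⟩).ne' h

/-- Each arc meets the axis only at its two ends, and the order of their `x¹`-coordinates excludes
an exchange. -/
theorem ends_eq_of_network_eq (H : IsLensArc c) (K : IsLensArc d)
    (h : lensNetwork c = lensNetwork d) : c (-1) = d (-1) ∧ c 1 = d 1 := by
  have him := H.image_eq_of_network_eq K h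
  have key : ∀ {c d : ℝ → Plane}, IsLensArc c → IsLensArc d →
      c '' paramInterval = d '' paramInterval → ∀ e ∈ paramInterval, c e 1 = 0 →
      c e = d (-1) ∨ c e = d 1 := by
    intro c d _ K him e he h0
    obtain ⟨x, hx, hxe⟩ : c e ∈ d '' paramInterval := him ▸ mem_image_of_mem c he
    rw [← hxe] at h0 ⊢
    rcases K.eq_end_of_mem_axis hx h0 with rfl | rfl
    · exact Or.inl rfl
    · exact Or.inr rfl
  have h1 := key H K him (-1) neg_one_mem_paramInterval H.left_mem_axis
  have h2 := key H K him 1 one_mem_paramInterval H.right_mem_axis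
  have hlt := H.left_lt_right
  have hlt' := K.left_lt_right
  rcases h1 with h1 | h1 <;> rcases h2 with h2 | h2
  · rw [h1, h2] at hlt; exact (lt_irrefl _ hlt).elim
  · exact ⟨h1, h2⟩
  · rw [h1, h2] at hlt; exact (lt_asymm hlt hlt').elim
  · rw [h1, h2] at hlt; exact (lt_irrefl _ hlt).elim

end IsLensArc

theorem lensNetwork_congr {c d : ℝ → Plane} (him : c '' paramInterval = d '' paramInterval)
    (hl : c (-1) = d (-1)) (hr : c 1 = d 1) : lensNetwork c = lensNetwork d := by
  simp only [lensNetwork, him, hl, hr]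

/-! ### Shrinking lens arcs -/

/-- The curvature vector of `c` is `μ` times the normal part of the position vector. -/
def HasShrinkingCurvature (μ : ℝ) (c : ℝ → Plane) : Prop :=
  ∀ x ∈ Ioo (-1 : ℝ) 1, ∀ ν : Plane, ‖ν‖ = 1 → inner ℝ (curveDeriv c x) ν = 0 →
    inner ℝ (curveDeriv2 c x) ν / ‖curveDeriv c x‖ ^ 2 = μ * inner ℝ (c x) ν

namespace IsLensArc

variable {c : ℝ → Plane} {μ : ℝ}

theorem isShrinkingArc (H : IsLensArc c) (hμ : HasShrinkingCurvature μ c) :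
    IsShrinkingArc μ (fun x => c x 0) (fun x => c x 1) (fun x => curveDeriv c x 0)
      (fun x => curveDeriv c x 1) (fun x => curveDeriv2 c x 0) (fun x => curveDeriv2 c x 1) where
  continuousOn_X := H.smooth.continuousOn.plane_coord 0
  continuousOn_Y := H.smooth.continuousOn.plane_coord 1
  continuousOn_a := H.contDiffOn_deriv.continuousOn.plane_coord 0
  continuousOn_b := H.contDiffOn_deriv.continuousOn.plane_coord 1
  deriv_X x hx := (H.hasDerivAt hx).plane_coord 0
  deriv_Y x hx := (H.hasDerivAt hx).plane_coord 1
  deriv_a x hx := (H.hasDerivAt_deriv hx).plane_coord 0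
  deriv_b x hx := (H.hasDerivAt_deriv hx).plane_coord 1
  regular x hx := by
    rw [← Plane.norm_sq_eq]
    have := norm_pos_iff.2 (H.regular x hx)
    positivity
  curvature x hx := by
    have hn := norm_pos_iff.2 (H.regular x (Ioo_subset_Icc_self hx))
    have hn2 := Plane.norm_sq_eq (curveDeriv c x)
    set r := ‖curveDeriv c x‖
    have h := hμ x hx !₂[-(curveDeriv c x 1) / r, curveDeriv c x 0 / r] (by
      rw [Plane.norm_eq, Real.sqrt_eq_one]
      simp only [Matrix.cons_val_zero, Matrix.cons_val_one]
      field_simp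
      linarith) (by
      rw [Plane.inner_eq]
      simp only [Matrix.cons_val_zero, Matrix.cons_val_one]
      field_simp
      ring)
    rw [Plane.inner_eq, Plane.inner_eq] at h
    simp only [Matrix.cons_val_zero, Matrix.cons_val_one] at h
    rw [← hn2]
    change _ / r ^ 2 = _ at h
    field_simp at h
    linear_combination h
  Y_left := H.left_mem_axis
  Y_right := H.right_mem_axis
  Y_pos := H.upper
  X_lt := H.left_lt_right
  a_left := H.deriv_left.1
  b_left := H.deriv_left.2
  a_right := H.deriv_right.1
  b_right := H.deriv_right.2

end IsLensArc

/-- Without curvature the unit tangent would be constant, but its second component is positive at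
the left end and negative at the right end. -/
theorem IsShrinkingArc.ne_zero {μ : ℝ} {X Y a b a₂ b₂ : ℝ → ℝ}
    (H : IsShrinkingArc μ X Y a b a₂ b₂) : μ ≠ 0 := by
  rintro rfl
  have h := eq_of_hasDerivAt_zero (f := fun x => b x / √(a x ^ 2 + b x ^ 2))
    (H.continuousOn_b.div H.continuousOn_speed fun x hx => (H.speed_pos hx).ne')
    (fun x hx => by
      have hr := H.speed_pos (Ioo_subset_Icc_self hx)
      have hr2 := H.speed_mul_self (Ioo_subset_Icc_self hx)
      refine ((H.deriv_b x hx).div (H.hasDerivAt_speed hx) hr.ne').congr_deriv ?_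
      have hc := H.curvature x hx
      generalize √(a x ^ 2 + b x ^ 2) = r at *
      field_simp
      linear_combination b₂ x * hr2 + a x * hc)
    neg_one_mem_paramInterval one_mem_paramInterval
  have h1 : 0 < b (-1) / √(a (-1) ^ 2 + b (-1) ^ 2) := by
    rw [div_pos_iff_of_pos_right (H.speed_pos neg_one_mem_paramInterval), H.b_left]
    have := H.a_left
    positivity
  have h2 : b 1 / √(a 1 ^ 2 + b 1 ^ 2) < 0 := by
    refine div_neg_of_neg_of_pos ?_ (H.speed_pos one_mem_paramInterval)
    rw [H.b_right]
    have := H.a_right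
    have : 0 < √3 * a 1 := by positivity
    linarith
  linarith

/-- The curve with support function `h` and derivative `p` of the support function. -/
noncomputable def profileCurve (h p : ℝ → ℝ) (s : ℝ) : Plane :=
  !₂[h s * Real.sin s + p s * Real.cos s, h s * Real.cos s - p s * Real.sin s]

/-- The curve given by a support function, parametrised over `[-1, 1]`. -/
noncomputable def profileArc (h p : ℝ → ℝ) (x : ℝ) : Plane :=
  profileCurve h p (Real.pi / 3 * x)

/-- Up to scaling there is only one shrinking lens. -/
theorem IsLensArc.smul_network_eq {c : ℝ → Plane} {μ : ℝ} {h p : ℝ → ℝ} (H : IsLensArc c)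
    (hc : HasShrinkingCurvature μ c) (hμ : μ ≤ 0) (K : IsLensProfile h p) : μ < 0 ∧
    √(-μ) • c (-1) = profileArc h p (-1) ∧ √(-μ) • c 1 = profileArc h p 1 ∧
    (fun x => √(-μ) • c x) '' paramInterval = profileArc h p '' paramInterval := by
  have hA := H.isShrinkingArc hc
  have hμ₀ : μ < 0 := lt_of_le_of_ne hμ hA.ne_zero
  have hπ := Real.pi_pos
  obtain ⟨k, q, g, K', hg, hgs, hgl, hgr, hpos⟩ := hA.exists_profile hμ₀
  obtain ⟨e1, e2⟩ := K'.unique K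
  have hcurve : ∀ s ∈ angleInterval, √(-μ) • c (g s) = profileCurve h p s := by
    intro s hs
    obtain ⟨h1, h2⟩ := hpos s hs
    rw [e1 hs, e2 hs] at h1 h2
    exact Plane.ext_coord h1 h2
  have hl : -(Real.pi / 3) ∈ angleInterval := ⟨le_rfl, by linarith⟩
  have hr : Real.pi / 3 ∈ angleInterval := ⟨by linarith, le_rfl⟩
  refine ⟨hμ₀, ?_, ?_, ?_⟩
  · rw [profileArc, mul_neg_one, ← hcurve _ hl, hgl]
  · rw [profileArc, mul_one, ← hcurve _ hr, hgr]
  · ext P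
    constructor
    · rintro ⟨x, hx, rfl⟩
      obtain ⟨s, hs, rfl⟩ := hgs hx
      refine ⟨s / (Real.pi / 3), ⟨?_, ?_⟩, ?_⟩
      · rw [le_div_iff₀ (by positivity)]; linarith [hs.1]
      · rw [div_le_iff₀ (by positivity)]; linarith [hs.2]
      · rw [profileArc, mul_div_cancel₀ _ (by positivity)]
        exact (hcurve s hs).symm
    · rintro ⟨x, hx, rfl⟩
      have hs : Real.pi / 3 * x ∈ angleInterval := by
        constructor <;> nlinarith [hx.1, hx.2]
      exact ⟨g (Real.pi / 3 * x), hg hs, hcurve _ hs⟩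

/-! ### Self-similar families consist of shrinking arcs -/

/-- A differentiable path in the trace of a lens arc moves tangentially. -/
theorem IsLensArc.inner_velocity_eq_zero {c : ℝ → Plane} (H : IsLensArc c) {q : ℝ → Plane}
    {q' : Plane} {t x : ℝ} (hx : x ∈ Ioo (-1 : ℝ) 1) (hq : HasDerivAt q q' t)
    (hmem : ∀ᶠ s in 𝓝 t, q s ∈ c '' paramInterval) (hqt : q t = c x) {ν : Plane}
    (hν : inner ℝ (curveDeriv c x) ν = 0) : inner ℝ q' ν = 0 := by
  have hx' := Ioo_subset_Icc_self hx
  -- Continuity of `φ` at `t` suffices. By regularity `y - x` is `O(c y - c x)`, so the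
  -- `ν`-component of `c y - c x` is of smaller order than `c y - c x` itself. Composed with `φ`,
  -- this bounds the `ν`-component of `q s - q t` by `o(q s - q t)`, hence by `o(s - t)`.
  set φ : ℝ → ℝ := fun s => Function.invFunOn c paramInterval (q s)
  have hφ : ∀ᶠ s in 𝓝 t, φ s ∈ paramInterval ∧ c (φ s) = q s :=
    hmem.mono fun s hs => ⟨Function.invFunOn_mem hs, Function.invFunOn_eq hs⟩
  have hφx : Tendsto φ (𝓝 t) (𝓝 x) := by
    refine tendsto_of_injOn_of_isCompact isCompact_Icc H.smooth.continuousOn H.embedded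
      (hφ.mono fun s hs => hs.1) hx' ?_
    rw [← hqt]
    exact hq.continuousAt.tendsto.congr' (hφ.mono fun s hs => hs.2.symm)
  have hc := H.hasDerivAt hx
  have h1 : (fun y => inner ℝ (c y) ν - inner ℝ (c x) ν) =o[𝓝 x] fun y => y - x := by
    have h2 : HasDerivAt (fun y => inner ℝ (c y) ν) 0 x :=
      (hc.inner ℝ (hasDerivAt_const x ν)).congr_deriv (by rw [hν, inner_zero_right, add_zero])
    simpa using h2.isLittleO
  have h3 : (fun y => y - x) =O[𝓝 x] fun y => c y - c x :=
    (hc.hasFDerivAt.isTheta_sub <| by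
      have hne := H.regular x hx'
      refine AntilipschitzWith.isInducing (K := ‖curveDeriv c x‖₊⁻¹) ?_ (map_continuous _)
      simp [antilipschitzWith_iff_le_mul_dist, dist_eq_norm, ← sub_smul, norm_smul,
        field]).isBigO_symm
  have h4 : (fun s => inner ℝ (c (φ s)) ν - inner ℝ (c x) ν) =o[𝓝 t]
      fun s => c (φ s) - c x := (h1.trans_isBigO h3).comp_tendsto hφx
  have h5 : (fun s => inner ℝ (q s) ν - inner ℝ (q t) ν) =o[𝓝 t] fun s => s - t := by
    have h6 : (fun s => inner ℝ (q s) ν - inner ℝ (q t) ν) =o[𝓝 t] fun s => q s - q t := by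
      rw [hqt]
      refine h4.congr' (hφ.mono fun s hs => ?_) (hφ.mono fun s hs => ?_) <;> simp only [hs.2]
    exact h6.trans_isBigO hq.isBigO_sub
  have h7 : HasDerivAt (fun s => inner ℝ (q s) ν) 0 t := by
    rw [hasDerivAt_iff_isLittleO]
    simpa using h5
  have h8 := hq.inner ℝ (hasDerivAt_const t ν)
  simpa using h8.unique h7

namespace IsLensArc

/-- The distance of the two triple points. -/
def width (c : ℝ → Plane) : ℝ := c 1 0 - c (-1) 0

end IsLensArc

section Family

variable {M : ℝ → Set Plane} {γ : ℝ → ℝ → Plane}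

/-- The homothety maps ends to ends, so its factor is the quotient of the widths, a differentiable
function of time. -/
theorem family_scaling (hS : ShrinksSelfSimilarly M)
    (hγ : ∀ t < 0, IsLensArc (γ t) ∧ M t = lensNetwork (γ t)) {s t : ℝ} (hst : s < t)
    (ht : t < 0) : IsLensArc.width (γ t) < IsLensArc.width (γ s) ∧
      (fun x => (IsLensArc.width (γ t) / IsLensArc.width (γ s)) • γ s x) '' paramInterval
        = γ t '' paramInterval := by
  obtain ⟨r, hr, hr1, hM⟩ := hS s t hst ht
  obtain ⟨Hs, hMs⟩ := hγ s (hst.trans ht)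
  obtain ⟨Ht, hMt⟩ := hγ t ht
  rw [homothety_zero_image, hMs, hMt, image_smul_lensNetwork hr] at hM
  obtain ⟨e1, e2⟩ := Ht.ends_eq_of_network_eq (Hs.smul hr) hM
  have hpos : 0 < IsLensArc.width (γ s) := sub_pos.2 Hs.left_lt_right
  have hw : IsLensArc.width (γ t) = r * IsLensArc.width (γ s) := by
    simp only [IsLensArc.width, e1, e2, PiLp.smul_apply, smul_eq_mul]
    ring
  refine ⟨by rw [hw]; nlinarith, ?_⟩
  rw [hw, mul_div_cancel_right₀ _ hpos.ne']
  exact (Ht.image_eq_of_network_eq (Hs.smul hr) hM).symm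

theorem family_image (hS : ShrinksSelfSimilarly M)
    (hγ : ∀ t < 0, IsLensArc (γ t) ∧ M t = lensNetwork (γ t)) {s t : ℝ} (hs : s < 0)
    (ht : t < 0) :
    (fun x => (IsLensArc.width (γ t) / IsLensArc.width (γ s)) • γ s x) '' paramInterval
        = γ t '' paramInterval := by
  have hps : 0 < IsLensArc.width (γ s) := sub_pos.2 (hγ s hs).1.left_lt_right
  have hpt : 0 < IsLensArc.width (γ t) := sub_pos.2 (hγ t ht).1.left_lt_right
  rcases lt_trichotomy s t with h | h | h
  · exact (family_scaling hS hγ h ht).2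
  · subst h
    simp [div_self hps.ne']
  · rw [← image_image (fun p : Plane => (IsLensArc.width (γ t) / IsLensArc.width (γ s)) • p),
      ← (family_scaling hS hγ h hs).2, image_image]
    have h1 : IsLensArc.width (γ t) / IsLensArc.width (γ s) *
      (IsLensArc.width (γ s) / IsLensArc.width (γ t)) = 1 := by field_simp
    simp only [smul_smul, h1, one_smul]

theorem hasDerivAt_width (hF : IsCurveShorteningFlow γ) {t : ℝ} (ht : t < 0) :
    HasDerivAt (fun s => IsLensArc.width (γ s))
      (deriv (fun s => γ s 1) t 0 - deriv (fun s => γ s (-1)) t 0) t :=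
  ((hF.differentiable_time t ht 1 one_mem_paramInterval).hasDerivAt.plane_coord 0).sub
    ((hF.differentiable_time t ht (-1) neg_one_mem_paramInterval).hasDerivAt.plane_coord 0)

/-- For fixed `x` the path `s ↦ (L t / L s) γ s x` stays in the trace of `γ t`, so its velocity at
`s = t`, namely the velocity of `γ` minus `(L'/L) γ`, is tangential. The flow equation then gives
the shrinker equation with `μ = L'/L`. -/
theorem family_hasShrinkingCurvature (hS : ShrinksSelfSimilarly M)
    (hγ : ∀ t < 0, IsLensArc (γ t) ∧ M t = lensNetwork (γ t)) (hF : IsCurveShorteningFlow γ)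
    {t : ℝ} (ht : t < 0) :
    HasShrinkingCurvature (deriv (fun s => IsLensArc.width (γ s)) t / IsLensArc.width (γ t))
      (γ t) ∧ deriv (fun s => IsLensArc.width (γ s)) t ≤ 0 := by
  have hw := (hasDerivAt_width hF ht).differentiableAt.hasDerivAt
  set L := fun s => IsLensArc.width (γ s) with hL
  have hpt : 0 < L t := sub_pos.2 (hγ t ht).1.left_lt_right
  constructor
  · intro x hx ν hν1 hν
    rw [← hF.flow t ht x hx ν hν1 hν]
    have hγd := (hF.differentiable_time t ht x (Ioo_subset_Icc_self hx)).hasDerivAt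
    have hq : HasDerivAt (fun s => (L t / L s) • γ s x)
        ((L t / L t) • deriv (fun s => γ s x) t + (-(deriv L t / L t)) • γ t x) t := by
      refine (((hasDerivAt_const t (L t)).div hw hpt.ne').smul hγd).congr_deriv ?_
      congr 2
      field_simp
      ring
    have h0 := (hγ t ht).1.inner_velocity_eq_zero hx hq (by
      filter_upwards [Iio_mem_nhds ht] with s hs
      rw [← family_image hS hγ hs ht]
      exact ⟨x, Ioo_subset_Icc_self hx, rfl⟩) (by simp [div_self hpt.ne']) hν
    rw [div_self hpt.ne', one_smul, inner_add_left, real_inner_smul_left] at h0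
    show _ = deriv L t / L t * _
    linarith
  · refine hw.nonpos_of_left ?_
    filter_upwards [self_mem_nhdsWithin] with s hs
    exact (family_scaling hS hγ hs ht).1.le

/-- All arcs are similar, so the width is a fixed multiple of the height of the rescaled point `γ
(-1) 0`; that height is at most the Hausdorff distance to the axis. -/
theorem tendsto_width_zero (hS : ShrinksSelfSimilarly M)
    (hγ : ∀ t < 0, IsLensArc (γ t) ∧ M t = lensNetwork (γ t)) (hC : ConvergesToX1Axis M) :
    Tendsto (fun s => IsLensArc.width (γ s)) (𝓝[<] 0) (𝓝 0) := by
  have h1 : (-1 : ℝ) < 0 := by norm_num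
  have H := (hγ _ h1).1
  have hp : 0 < IsLensArc.width (γ (-1)) := sub_pos.2 H.left_lt_right
  have hy : 0 < γ (-1) 0 1 := H.upper 0 (by constructor <;> norm_num)
  have hle : ∀ᶠ t in 𝓝[<] (0 : ℝ), ENNReal.ofReal (IsLensArc.width (γ t)) ≤
      ENNReal.ofReal (IsLensArc.width (γ (-1)) / γ (-1) 0 1) *
        Metric.hausdorffEDist (M t) x1Axis := by
    filter_upwards [self_mem_nhdsWithin] with t ht
    have ht' : t < 0 := ht
    have hpt : 0 < IsLensArc.width (γ t) := sub_pos.2 (hγ t ht').1.left_lt_right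
    set P : Plane := (IsLensArc.width (γ t) / IsLensArc.width (γ (-1))) • γ (-1) 0
    have hP : P ∈ M t := by
      rw [(hγ t ht').2]
      refine Or.inl (Or.inl (Or.inl ?_))
      rw [← family_image hS hγ h1 ht']
      exact ⟨0, by constructor <;> norm_num, rfl⟩
    have h2 : Metric.infEDist P x1Axis ≤ Metric.hausdorffEDist (M t) x1Axis :=
      Metric.infEDist_le_hausdorffEDist_of_mem hP
    have h3 : ENNReal.ofReal (P 1) ≤ Metric.infEDist P x1Axis := by
      refine Metric.le_infEDist.2 fun q hq => ?_
      have hq1 : q 1 = 0 := hq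
      rw [edist_dist]
      refine ENNReal.ofReal_le_ofReal ?_
      have := PiLp.norm_apply_le (P - q) 1
      rw [dist_eq_norm]
      refine le_trans (le_trans (le_abs_self _) ?_) this
      simp [hq1]
    have h4 : IsLensArc.width (γ t) = IsLensArc.width (γ (-1)) / γ (-1) 0 1 * P 1 := by
      show _ = _ * (IsLensArc.width (γ t) / IsLensArc.width (γ (-1)) * γ (-1) 0 1)
      field_simp
    calc ENNReal.ofReal (IsLensArc.width (γ t))
        = ENNReal.ofReal (IsLensArc.width (γ (-1)) / γ (-1) 0 1) * ENNReal.ofReal (P 1) := by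
          rw [← ENNReal.ofReal_mul (by positivity), ← h4]
      _ ≤ _ := by gcongr; exact h3.trans h2
  have h5 : Tendsto (fun t => ENNReal.ofReal (IsLensArc.width (γ (-1)) / γ (-1) 0 1) *
      Metric.hausdorffEDist (M t) x1Axis) (𝓝[<] 0) (𝓝 0) := by
    have := ENNReal.Tendsto.const_mul (a := ENNReal.ofReal (IsLensArc.width (γ (-1)) / γ (-1) 0 1))
      hC (Or.inr ENNReal.ofReal_ne_top)
    rwa [mul_zero] at this
  have h6 : Tendsto (fun t => ENNReal.ofReal (IsLensArc.width (γ t))) (𝓝[<] 0) (𝓝 0) :=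
    tendsto_of_tendsto_of_tendsto_of_le_of_le' tendsto_const_nhds h5
      (Eventually.of_forall fun _ => zero_le) hle
  have h7 := (ENNReal.tendsto_toReal ENNReal.zero_ne_top).comp h6
  refine (h7.congr' ?_).trans (by simp)
  filter_upwards [self_mem_nhdsWithin] with t ht
  exact ENNReal.toReal_ofReal (sub_pos.2 (hγ t ht).1.left_lt_right).le

/-- Every shrinking family of lenses is the standard one. -/
theorem IsShrinkingLensFamily.eq_standard {h p : ℝ → ℝ} (K : IsLensProfile h p)
    (hM : IsShrinkingLensFamily M) {t : ℝ} (ht : t < 0) :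
    M t = lensNetwork fun x => √(-2 * t) • profileArc h p x := by
  obtain ⟨γ, hγ, hF⟩ := hM.isLensFlow
  have hS := hM.shrinks
  set L := fun s => IsLensArc.width (γ s) with hL
  set w := IsLensArc.width (profileArc h p) with hw
  have hpos : ∀ s < 0, 0 < L s := fun s hs => sub_pos.2 (hγ s hs).1.left_lt_right
  have hdL : ∀ s < 0, HasDerivAt L (deriv L s) s := fun s hs =>
    (hasDerivAt_width hF hs).differentiableAt.hasDerivAt
  have hstd : ∀ s < 0, deriv L s / L s < 0 ∧
      √(-(deriv L s / L s)) • γ s (-1) = profileArc h p (-1) ∧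
      √(-(deriv L s / L s)) • γ s 1 = profileArc h p 1 ∧
      (fun x => √(-(deriv L s / L s)) • γ s x) '' paramInterval
        = profileArc h p '' paramInterval := fun s hs =>
    have hc := family_hasShrinkingCurvature hS hγ hF hs
    (hγ s hs).1.smul_network_eq hc.1 (div_nonpos_of_nonpos_of_nonneg hc.2 (hpos s hs).le) K
  -- Comparing widths with the normalised profile yields `L L' = -w²`. Hence `L² + 2w² s` is
  -- constant, and the constant is 0 because `L → 0`.
  have hκ : ∀ s < 0, √(-(deriv L s / L s)) * L s = w := by
    intro s hs
    obtain ⟨-, e1, e2, -⟩ := hstd s hs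
    simp only [hw, IsLensArc.width, ← e1, ← e2, hL, PiLp.smul_apply, smul_eq_mul]
    ring
  have hode : ∀ s < 0, L s * deriv L s = -w ^ 2 := by
    intro s hs
    have h1 := Real.mul_self_sqrt (neg_pos.2 (hstd s hs).1).le
    have h2 := (hpos s hs).ne'
    rw [← hκ s hs]
    have h3 : deriv L s = deriv L s / L s * L s := by field_simp
    linear_combination L s * h3 + L s ^ 2 * h1
  have hconst : ∀ s < 0, ∀ u < 0, L s ^ 2 + 2 * w ^ 2 * s = L u ^ 2 + 2 * w ^ 2 * u := by
    intro s hs u hu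
    have hlt : ∀ v ∈ Icc (min s u) (max s u), v < 0 := fun v hv =>
      hv.2.trans_lt (max_lt hs hu)
    have hd : ∀ v < 0, HasDerivAt (fun v => L v ^ 2 + 2 * w ^ 2 * v) 0 v := by
      intro v hv
      refine (((hdL v hv).pow 2).add ((hasDerivAt_id v).const_mul (2 * w ^ 2))).congr_deriv ?_
      have := hode v hv
      simp
      linear_combination 2 * this
    exact eq_of_hasDerivAt_zero
      (fun v hv => (hd v (hlt v hv)).continuousAt.continuousWithinAt)
      (fun v hv => hd v (hlt v (Ioo_subset_Icc_self hv)))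
      ⟨min_le_left _ _, le_max_left _ _⟩ ⟨min_le_right _ _, le_max_right _ _⟩
  have hL0 := tendsto_width_zero hS hγ hM.converges
  have hlim : Tendsto (fun s => L s ^ 2 + 2 * w ^ 2 * s) (𝓝[<] 0)
      (𝓝 (0 ^ 2 + 2 * w ^ 2 * 0)) :=
    (hL0.pow 2).add ((tendsto_id'.2 nhdsWithin_le_nhds).const_mul _)
  have hzero : L t ^ 2 + 2 * w ^ 2 * t = 0 := by
    have h1 : Tendsto (fun s => L s ^ 2 + 2 * w ^ 2 * s) (𝓝[<] 0)
        (𝓝 (L t ^ 2 + 2 * w ^ 2 * t)) := by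
      refine tendsto_const_nhds.congr' ?_
      filter_upwards [self_mem_nhdsWithin] with s hs using hconst t ht s hs
    rw [tendsto_nhds_unique h1 hlim]
    ring
  obtain ⟨hneg, e1, e2, e3⟩ := hstd t ht
  have hκt := hκ t ht
  set κ := √(-(deriv L t / L t))
  have hκ0 : 0 < κ := Real.sqrt_pos.2 (neg_pos.2 hneg)
  have hκinv : √(-2 * t) = κ⁻¹ := by
    rw [Real.sqrt_eq_iff_mul_self_eq (by linarith) (inv_nonneg.2 hκ0.le)]
    have hLt := (hpos t ht).ne'
    rw [← hκt] at hzero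
    have h2 : L t ^ 2 * (1 + 2 * κ ^ 2 * t) = 0 := by linear_combination hzero
    have h3 : 1 + 2 * κ ^ 2 * t = 0 := by
      rcases mul_eq_zero.1 h2 with h4 | h4
      · exact absurd h4 (pow_ne_zero 2 hLt)
      · exact h4
    field_simp
    linarith
  have hnet := lensNetwork_congr (c := fun x => κ • γ t x) e3 e1 e2
  rw [(hγ t ht).2, hκinv, ← image_smul_lensNetwork (inv_pos.2 hκ0), ← hnet,
    image_smul_lensNetwork (inv_pos.2 hκ0)]
  simp only [inv_smul_smul₀ hκ0.ne']

end Family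

/-! ### The standard family -/

/-- A lens profile together with an extension of the differential equation beyond the end points. -/
structure IsExtendedProfile (h p : ℝ → ℝ) : Prop extends IsLensProfile h p where
  ode : ∀ s ∈ Ioo (-(11 / 10) : ℝ) (11 / 10), 0 < h s ∧ HasDerivAt h (p s) s ∧
    HasDerivAt p ((h s)⁻¹ - h s) s

namespace IsExtendedProfile

variable {h p : ℝ → ℝ}

/-- Bootstrap: the equation expresses the derivatives of `h` and `p` smoothly through `h > 0` and
`p`. -/
theorem contDiffOn (H : IsExtendedProfile h p) :
    ContDiffOn ℝ ∞ h (Ioo (-(11 / 10)) (11 / 10)) ∧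
      ContDiffOn ℝ ∞ p (Ioo (-(11 / 10)) (11 / 10)) := by
  have key : ∀ n : ℕ, ContDiffOn ℝ n h (Ioo (-(11 / 10)) (11 / 10)) ∧
      ContDiffOn ℝ n p (Ioo (-(11 / 10)) (11 / 10)) := by
    intro n
    induction n with
    | zero =>
      simp only [Nat.cast_zero, contDiffOn_zero]
      exact ⟨fun s hs => (H.ode s hs).2.1.continuousAt.continuousWithinAt,
        fun s hs => (H.ode s hs).2.2.continuousAt.continuousWithinAt⟩
    | succ n ih =>
      have hdh : DifferentiableOn ℝ h (Ioo (-(11 / 10)) (11 / 10)) := fun s hs =>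
        (H.ode s hs).2.1.differentiableAt.differentiableWithinAt
      have hdp : DifferentiableOn ℝ p (Ioo (-(11 / 10)) (11 / 10)) := fun s hs =>
        (H.ode s hs).2.2.differentiableAt.differentiableWithinAt
      push_cast
      rw [contDiffOn_succ_iff_deriv_of_isOpen isOpen_Ioo,
        contDiffOn_succ_iff_deriv_of_isOpen isOpen_Ioo]
      refine ⟨⟨hdh, by simp, ih.2.congr fun s hs => (H.ode s hs).2.1.deriv⟩, hdp, by simp, ?_⟩
      exact ((ih.1.inv fun s hs => (H.ode s hs).1.ne').sub ih.1).congr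
        fun s hs => (H.ode s hs).2.2.deriv
  exact ⟨contDiffOn_infty.2 fun n => (key n).1, contDiffOn_infty.2 fun n => (key n).2⟩

theorem mem_Ioo {x : ℝ} (hx : x ∈ paramInterval) :
    Real.pi / 3 * x ∈ Ioo (-(11 / 10) : ℝ) (11 / 10) := by
  have h1 := Real.pi_lt_d2
  have h2 := Real.pi_pos
  constructor <;> nlinarith [hx.1, hx.2]

theorem mem_angleInterval {x : ℝ} (hx : x ∈ paramInterval) : Real.pi / 3 * x ∈ angleInterval := by
  have h2 := Real.pi_pos
  constructor <;> nlinarith [hx.1, hx.2]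

theorem contDiffOn_profileArc (H : IsExtendedProfile h p) :
    ContDiffOn ℝ ∞ (profileArc h p) paramInterval := by
  have hlin : ContDiffOn ℝ ∞ (fun x : ℝ => Real.pi / 3 * x) paramInterval :=
    (contDiff_const.mul contDiff_id).contDiffOn
  have hh : ContDiffOn ℝ ∞ (fun x => h (Real.pi / 3 * x)) paramInterval :=
    H.contDiffOn.1.comp hlin fun x hx => mem_Ioo hx
  have hp : ContDiffOn ℝ ∞ (fun x => p (Real.pi / 3 * x)) paramInterval :=
    H.contDiffOn.2.comp hlin fun x hx => mem_Ioo hx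
  have hs : ContDiffOn ℝ ∞ (fun x => Real.sin (Real.pi / 3 * x)) paramInterval :=
    Real.contDiff_sin.comp_contDiffOn hlin
  have hc : ContDiffOn ℝ ∞ (fun x => Real.cos (Real.pi / 3 * x)) paramInterval :=
    Real.contDiff_cos.comp_contDiffOn hlin
  rw [contDiffOn_euclidean]
  intro i
  fin_cases i
  · exact (hh.mul hs).add (hp.mul hc)
  · exact (hh.mul hc).sub (hp.mul hs)

theorem hasDerivAt_profileArc (H : IsExtendedProfile h p) {x : ℝ} (hx : x ∈ paramInterval) :
    HasDerivAt (profileArc h p)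
      !₂[Real.pi / 3 * ((h (Real.pi / 3 * x))⁻¹ * Real.cos (Real.pi / 3 * x)),
        -(Real.pi / 3 * ((h (Real.pi / 3 * x))⁻¹ * Real.sin (Real.pi / 3 * x)))] x := by
  obtain ⟨hpos, hh, hp⟩ := H.ode _ (mem_Ioo hx)
  have hl : HasDerivAt (fun x => Real.pi / 3 * x) (Real.pi / 3) x := by
    simpa using (hasDerivAt_id x).const_mul (Real.pi / 3)
  have hh' := hh.comp x hl
  have hp' := hp.comp x hl
  have hne := hpos.ne'
  refine ((((hh'.mul hl.sin).add (hp'.mul hl.cos)).congr_deriv ?_).plane_mk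
    (((hh'.mul hl.cos).sub (hp'.mul hl.sin)).congr_deriv ?_))
  · simp only [Function.comp_apply]
    ring
  · simp only [Function.comp_apply]
    ring

theorem curveDeriv_profileArc (H : IsExtendedProfile h p) {x : ℝ} (hx : x ∈ paramInterval) :
    curveDeriv (profileArc h p) x =
      !₂[Real.pi / 3 * ((h (Real.pi / 3 * x))⁻¹ * Real.cos (Real.pi / 3 * x)),
        -(Real.pi / 3 * ((h (Real.pi / 3 * x))⁻¹ * Real.sin (Real.pi / 3 * x)))] :=
  (H.hasDerivAt_profileArc hx).hasDerivWithinAt.derivWithin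
    (uniqueDiffOn_Icc (by norm_num) x hx)

theorem curveDeriv2_profileArc (H : IsExtendedProfile h p) {x : ℝ} (hx : x ∈ paramInterval) :
    curveDeriv2 (profileArc h p) x =
      !₂[(Real.pi / 3) ^ 2 * (-p (Real.pi / 3 * x) / h (Real.pi / 3 * x) ^ 2 *
          Real.cos (Real.pi / 3 * x) - (h (Real.pi / 3 * x))⁻¹ * Real.sin (Real.pi / 3 * x)),
        -((Real.pi / 3) ^ 2 * (-p (Real.pi / 3 * x) / h (Real.pi / 3 * x) ^ 2 *
          Real.sin (Real.pi / 3 * x) + (h (Real.pi / 3 * x))⁻¹ *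
            Real.cos (Real.pi / 3 * x)))] := by
  obtain ⟨hpos, hh, hp⟩ := H.ode _ (mem_Ioo hx)
  have hl : HasDerivAt (fun x => Real.pi / 3 * x) (Real.pi / 3) x := by
    simpa using (hasDerivAt_id x).const_mul (Real.pi / 3)
  have hi := (hh.comp x hl).fun_inv hpos.ne'
  have hd := ((((hi.mul hl.cos).const_mul (Real.pi / 3)).congr_deriv
    (g' := (Real.pi / 3) ^ 2 * (-p (Real.pi / 3 * x) / h (Real.pi / 3 * x) ^ 2 *
      Real.cos (Real.pi / 3 * x) - (h (Real.pi / 3 * x))⁻¹ * Real.sin (Real.pi / 3 * x)))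
      (by simp only [Function.comp_apply]; ring)).plane_mk
    ((((hi.mul hl.sin).const_mul (Real.pi / 3)).neg).congr_deriv
    (g' := -((Real.pi / 3) ^ 2 * (-p (Real.pi / 3 * x) / h (Real.pi / 3 * x) ^ 2 *
          Real.sin (Real.pi / 3 * x) + (h (Real.pi / 3 * x))⁻¹ * Real.cos (Real.pi / 3 * x))))
      (by simp only [Function.comp_apply]; ring)))
  have := hd.hasDerivWithinAt.derivWithin (uniqueDiffOn_Icc (by norm_num) x hx)
  rw [← this]
  exact derivWithin_congr (fun y hy => H.curveDeriv_profileArc hy) (H.curveDeriv_profileArc hx)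

theorem norm_curveDeriv (H : IsExtendedProfile h p) {x : ℝ} (hx : x ∈ paramInterval) :
    ‖curveDeriv (profileArc h p) x‖ = Real.pi / 3 * (h (Real.pi / 3 * x))⁻¹ := by
  have hpos := (H.ode _ (mem_Ioo hx)).1
  have hπ := Real.pi_pos
  rw [H.curveDeriv_profileArc hx, Plane.norm_eq, Real.sqrt_eq_iff_mul_self_eq (by positivity)
    (by positivity)]
  simp only [Matrix.cons_val_zero, Matrix.cons_val_one]
  linear_combination (Real.pi / 3 * (h (Real.pi / 3 * x))⁻¹) ^ 2 *
    Real.sin_sq_add_cos_sq (Real.pi / 3 * x)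

theorem strictMonoOn_profileArc (H : IsExtendedProfile h p) :
    StrictMonoOn (fun x => profileArc h p x 0) paramInterval := by
  refine strictMonoOn_Icc_of_hasDerivAt (H.contDiffOn_profileArc.continuousOn.plane_coord 0)
    (fun x hx => (H.hasDerivAt_profileArc (Ioo_subset_Icc_self hx)).plane_coord 0) fun x hx => ?_
  have hpos := (H.ode _ (mem_Ioo (Ioo_subset_Icc_self hx))).1
  have hπ := Real.pi_pos
  have hm := mem_angleInterval (Ioo_subset_Icc_self hx)
  have hc : 0 < Real.cos (Real.pi / 3 * x) :=
    Real.cos_pos_of_mem_Ioo ⟨by linarith [hm.1], by linarith [hm.2]⟩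
  show 0 < Real.pi / 3 * ((h (Real.pi / 3 * x))⁻¹ * Real.cos (Real.pi / 3 * x))
  positivity

theorem profileArc_left (H : IsExtendedProfile h p) : profileArc h p (-1) 1 = 0 := by
  have := H.height_left
  simpa [profileArc, profileCurve] using this

theorem profileArc_right (H : IsExtendedProfile h p) : profileArc h p 1 1 = 0 := by
  have := H.height_right
  simpa [profileArc, profileCurve] using this

theorem profileArc_pos (H : IsExtendedProfile h p) {x : ℝ} (hx : x ∈ Ioo (-1 : ℝ) 1) :
    0 < profileArc h p x 1 := by
  have hπ := Real.pi_pos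
  have hc := H.contDiffOn_profileArc.continuousOn.plane_coord 1
  rcases le_total 0 x with h0 | h0
  · have hsub : Icc (0 : ℝ) 1 ⊆ paramInterval := Icc_subset_Icc (by norm_num) le_rfl
    have hm := strictMonoOn_Icc_of_hasDerivAt (hc.mono hsub).neg
      (fun y hy => ((H.hasDerivAt_profileArc (hsub (Ioo_subset_Icc_self hy))).plane_coord 1).neg)
      (fun y hy => by
        have hy' := hsub (Ioo_subset_Icc_self hy)
        have hpos := (H.ode _ (mem_Ioo hy')).1
        have hs : 0 < Real.sin (Real.pi / 3 * y) :=
          Real.sin_pos_of_pos_of_lt_pi (mul_pos (by positivity) hy.1)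
            (by linarith [(mem_angleInterval hy').2])
        show 0 < -(-(Real.pi / 3 * ((h (Real.pi / 3 * y))⁻¹ * Real.sin (Real.pi / 3 * y))))
        rw [neg_neg]
        positivity)
      ⟨h0, hx.2.le⟩ (right_mem_Icc.2 zero_le_one) hx.2
    have h1 : -profileArc h p x 1 < -profileArc h p 1 1 := hm
    rw [H.profileArc_right] at h1
    linarith
  · have hsub : Icc (-1 : ℝ) 0 ⊆ paramInterval := Icc_subset_Icc le_rfl (by norm_num)
    have hm := strictMonoOn_Icc_of_hasDerivAt (hc.mono hsub)
      (fun y hy => (H.hasDerivAt_profileArc (hsub (Ioo_subset_Icc_self hy))).plane_coord 1)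
      (fun y hy => by
        have hy' := hsub (Ioo_subset_Icc_self hy)
        have hpos := (H.ode _ (mem_Ioo hy')).1
        have hs : Real.sin (Real.pi / 3 * y) < 0 :=
          Real.sin_neg_of_neg_of_neg_pi_lt (mul_neg_of_pos_of_neg (by positivity) hy.2)
            (by linarith [(mem_angleInterval hy').1])
        show 0 < -(Real.pi / 3 * ((h (Real.pi / 3 * y))⁻¹ * Real.sin (Real.pi / 3 * y)))
        have : 0 < Real.pi / 3 * ((h (Real.pi / 3 * y))⁻¹ * -Real.sin (Real.pi / 3 * y)) := by
          have := neg_pos.2 hs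
          positivity
        linarith)
      (left_mem_Icc.2 (by norm_num)) ⟨hx.1.le, h0⟩ hx.1
    have h1 : profileArc h p (-1) 1 < profileArc h p x 1 := hm
    rwa [H.profileArc_left] at h1

theorem isLensArc (H : IsExtendedProfile h p) : IsLensArc (profileArc h p) where
  smooth := H.contDiffOn_profileArc
  regular x hx := by
    have hpos := (H.ode _ (mem_Ioo hx)).1
    have hπ := Real.pi_pos
    rw [← norm_pos_iff, H.norm_curveDeriv hx]
    positivity
  embedded x hx y hy hxy :=
    H.strictMonoOn_profileArc.injOn hx hy (congrArg (fun P : Plane => P 0) hxy)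
  upper x hx := H.profileArc_pos hx
  left_mem_axis := H.profileArc_left
  right_mem_axis := H.profileArc_right
  left_lt_right := H.strictMonoOn_profileArc neg_one_mem_paramInterval one_mem_paramInterval
    (by norm_num)
  angle_left := by
    have hpos := (H.ode _ (mem_Ioo neg_one_mem_paramInterval)).1
    have hπ := Real.pi_pos
    rw [H.norm_curveDeriv neg_one_mem_paramInterval,
      H.curveDeriv_profileArc neg_one_mem_paramInterval]
    rw [mul_neg_one] at hpos ⊢
    have hne := hpos.ne'
    rw [Real.cos_neg, Real.sin_neg, Real.cos_pi_div_three, Real.sin_pi_div_three]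
    refine Plane.ext_coord ?_ ?_
    · simp only [PiLp.smul_apply, smul_eq_mul, Matrix.cons_val_zero]
      field_simp
    · simp only [PiLp.smul_apply, smul_eq_mul, Matrix.cons_val_one, Matrix.cons_val_zero]
      field_simp
  angle_right := by
    have hpos := (H.ode _ (mem_Ioo one_mem_paramInterval)).1
    have hπ := Real.pi_pos
    rw [H.norm_curveDeriv one_mem_paramInterval,
      H.curveDeriv_profileArc one_mem_paramInterval]
    rw [mul_one] at hpos ⊢
    have hne := hpos.ne'
    rw [Real.cos_pi_div_three, Real.sin_pi_div_three]
    refine Plane.ext_coord ?_ ?_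
    · simp only [PiLp.smul_apply, smul_eq_mul, Matrix.cons_val_zero]
      field_simp
    · simp only [PiLp.smul_apply, smul_eq_mul, Matrix.cons_val_one, Matrix.cons_val_zero]
      field_simp

/-- In the normal-angle parametrisation the full vector identity `c'' = -|c'|² c` holds, tangential
part included. -/
theorem hasShrinkingCurvature (H : IsExtendedProfile h p) :
    HasShrinkingCurvature (-1) (profileArc h p) := by
  intro x hx ν _ _
  have hx' := Ioo_subset_Icc_self hx
  have hpos := (H.ode _ (mem_Ioo hx')).1
  have hπ := Real.pi_pos
  rw [H.norm_curveDeriv hx', H.curveDeriv2_profileArc hx', profileArc, profileCurve,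
    Plane.inner_eq, Plane.inner_eq]
  simp only [Matrix.cons_val_zero, Matrix.cons_val_one]
  generalize Real.cos (Real.pi / 3 * x) = C at *
  generalize Real.sin (Real.pi / 3 * x) = S at *
  generalize p (Real.pi / 3 * x) = P at *
  generalize h (Real.pi / 3 * x) = k at *
  field_simp
  ring

theorem even_profileArc (H : IsExtendedProfile h p) {x : ℝ} (hx : x ∈ paramInterval) :
    profileArc h p (-x) = reflectX2 (profileArc h p x) := by
  obtain ⟨e1, e2⟩ := H.even
  have hm := mem_angleInterval hx
  rw [profileArc, profileArc, mul_neg, profileCurve, profileCurve, e1 _ hm, e2 _ hm,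
    Real.sin_neg, Real.cos_neg]
  refine Plane.ext_coord ?_ ?_
  · simp only [reflectX2, Matrix.cons_val_zero]
    ring
  · simp only [reflectX2, Matrix.cons_val_one, Matrix.cons_val_zero]
    ring

end IsExtendedProfile

/-! ### Scaling a shrinking arc by the square root of time -/

section Scaling

variable {c : ℝ → Plane}

theorem sqrt_neg_two_mul_pos {t : ℝ} (ht : t < 0) : 0 < √(-2 * t) :=
  Real.sqrt_pos.2 (by linarith)

theorem hasDerivAt_sqrt_smul {t : ℝ} (ht : t < 0) (P : Plane) :
    HasDerivAt (fun s => √(-2 * s) • P) (-(√(-2 * t))⁻¹ • P) t := by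
  have h1 : HasDerivAt (fun s : ℝ => -2 * s) (-2) t := by
    simpa using (hasDerivAt_id t).const_mul (-2 : ℝ)
  have h2 := h1.sqrt (by linarith : -2 * t ≠ 0)
  refine (h2.smul_const P).congr_deriv ?_
  congr 1
  have := (sqrt_neg_two_mul_pos ht).ne'
  field_simp

/-- The factor `k = √(-2t)` has `k' = -1/k`, and dilation by `k` divides the curvature by `k`, so
both sides of the flow equation scale alike. -/
theorem IsLensArc.isCurveShorteningFlow (H : IsLensArc c) (hc : HasShrinkingCurvature (-1) c) :
    IsCurveShorteningFlow fun t x => √(-2 * t) • c x := by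
  have hs : ContinuousOn (fun p : ℝ × ℝ => √(-2 * p.1)) (Iio 0 ×ˢ paramInterval) := by fun_prop
  have hsnd : MapsTo (fun p : ℝ × ℝ => p.2) (Iio 0 ×ˢ paramInterval) paramInterval :=
    fun p hp => hp.2
  refine ⟨?_, ?_, ?_, ?_, ?_, ?_⟩
  · exact hs.smul (H.smooth.continuousOn.comp continuousOn_snd hsnd)
  · exact (hs.smul (H.contDiffOn_deriv.continuousOn.comp continuousOn_snd hsnd)).congr
      fun p hp => H.curveDeriv_smul _ hp.2
  · exact (hs.smul (H.contDiffOn_deriv2.continuousOn.comp continuousOn_snd hsnd)).congr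
      fun p hp => H.curveDeriv2_smul _ hp.2
  · exact fun t ht x _ => (hasDerivAt_sqrt_smul ht (c x)).differentiableAt
  · refine (((hs.inv₀ fun p hp => (sqrt_neg_two_mul_pos hp.1).ne').neg).smul
      (H.smooth.continuousOn.comp continuousOn_snd hsnd)).congr
      fun p hp => (hasDerivAt_sqrt_smul hp.1 (c p.2)).deriv
  · intro t ht x hx ν hν1 hν
    have hx' := Ioo_subset_Icc_self hx
    have hk := sqrt_neg_two_mul_pos ht
    rw [(hasDerivAt_sqrt_smul ht (c x)).deriv, H.curveDeriv_smul _ hx', H.curveDeriv2_smul _ hx',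
      norm_smul, real_inner_smul_left, real_inner_smul_left, Real.norm_of_nonneg hk.le]
    rw [H.curveDeriv_smul _ hx', real_inner_smul_left] at hν
    have h1 := hc x hx ν hν1 ((mul_eq_zero.1 hν).resolve_left hk.ne')
    have hn := norm_pos_iff.2 (H.regular x hx')
    generalize √(-2 * t) = k at *
    field_simp at h1 ⊢
    linarith

theorem shrinksSelfSimilarly_sqrt_smul (c : ℝ → Plane) :
    ShrinksSelfSimilarly fun t => lensNetwork fun x => √(-2 * t) • c x := by
  intro s t hst ht
  have hs := sqrt_neg_two_mul_pos (hst.trans ht)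
  have ht' := sqrt_neg_two_mul_pos ht
  have hlt : √(-2 * t) < √(-2 * s) := Real.sqrt_lt_sqrt (by linarith) (by linarith)
  refine ⟨√(-2 * t) / √(-2 * s), by positivity, (div_lt_one hs).2 hlt, ?_⟩
  rw [homothety_zero_image, image_smul_lensNetwork (by positivity)]
  simp only [smul_smul, div_mul_cancel₀ _ hs.ne']

theorem Plane.dist_of_eq_zero {p q : Plane} (h : p 0 = q 0) : dist p q = |p 1 - q 1| := by
  rw [dist_eq_norm, Plane.norm_eq]
  simp [h, Real.sqrt_sq_eq_abs]

theorem Plane.dist_of_eq_one {p q : Plane} (h : p 1 = q 1) : dist p q = |p 0 - q 0| := by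
  rw [dist_eq_norm, Plane.norm_eq]
  simp [h, Real.sqrt_sq_eq_abs]

/-- Points of the network project vertically to the axis over a distance at most `C`. The factor 2
comes from axis points between the triple points, which are matched with the left one. -/
theorem IsLensArc.hausdorffEDist_le (H : IsLensArc c) {C : ℝ}
    (hC : ∀ x ∈ paramInterval, ‖c x‖ ≤ C) :
    Metric.hausdorffEDist (lensNetwork c) x1Axis ≤ ENNReal.ofReal (2 * C) := by
  have hl : c (-1) 1 = 0 := H.left_mem_axis
  have hC0 : 0 ≤ C := (norm_nonneg _).trans (hC 1 one_mem_paramInterval)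
  have hcoord : ∀ x ∈ paramInterval, ∀ i, |c x i| ≤ C := fun x hx i =>
    (PiLp.norm_apply_le (c x) i).trans (hC x hx)
  refine Metric.hausdorffEDist_le_of_mem_edist (fun p hp => ?_) fun q hq => ?_
  · refine ⟨!₂[p 0, 0], by simp [x1Axis], ?_⟩
    rw [edist_dist, Plane.dist_of_eq_zero (by simp)]
    refine ENNReal.ofReal_le_ofReal ?_
    suffices |p 1| ≤ C by
      simp only [Matrix.cons_val_one, Matrix.cons_val_zero, sub_zero]
      linarith
    rcases hp with ((⟨x, hx, rfl⟩ | ⟨_, ⟨x, hx, rfl⟩, rfl⟩) | ⟨h, -⟩) | ⟨h, -⟩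
    · exact hcoord x hx 1
    · simpa [reflectX1] using hcoord x hx 1
    · rw [h, abs_zero]; exact hC0
    · rw [h, abs_zero]; exact hC0
  · have hq1 : q 1 = 0 := hq
    rcases le_total (q 0) (c (-1) 0) with h1 | h1
    · exact ⟨q, Or.inl (Or.inr ⟨hq1, h1⟩), by simp⟩
    rcases le_total (c 1 0) (q 0) with h2 | h2
    · exact ⟨q, Or.inr ⟨hq1, h2⟩, by simp⟩
    refine ⟨c (-1), Or.inl (Or.inl (Or.inl ⟨-1, neg_one_mem_paramInterval, rfl⟩)), ?_⟩
    rw [edist_dist, Plane.dist_of_eq_one (by rw [hq1, hl]), abs_of_nonneg (by linarith)]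
    refine ENNReal.ofReal_le_ofReal ?_
    have h3 := abs_le.1 (hcoord 1 one_mem_paramInterval 0)
    have h4 := abs_le.1 (hcoord (-1) neg_one_mem_paramInterval 0)
    linarith [h3.2, h4.1]

theorem IsLensArc.convergesToX1Axis (H : IsLensArc c) :
    ConvergesToX1Axis fun t => lensNetwork fun x => √(-2 * t) • c x := by
  obtain ⟨C, hC⟩ := isCompact_Icc.exists_bound_of_continuousOn H.smooth.continuousOn
  have h1 : ∀ᶠ t in 𝓝[<] (0 : ℝ), Metric.hausdorffEDist (lensNetwork fun x => √(-2 * t) • c x)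
      x1Axis ≤ ENNReal.ofReal (2 * (√(-2 * t) * C)) := by
    filter_upwards [self_mem_nhdsWithin] with t ht
    refine (H.smul (sqrt_neg_two_mul_pos ht)).hausdorffEDist_le fun x hx => ?_
    rw [norm_smul, Real.norm_of_nonneg (Real.sqrt_nonneg _)]
    exact mul_le_mul_of_nonneg_left (hC x hx) (Real.sqrt_nonneg _)
  have h2 : Tendsto (fun t : ℝ => ENNReal.ofReal (2 * (√(-2 * t) * C))) (𝓝[<] 0) (𝓝 0) := by
    have h3 : Continuous fun t : ℝ => 2 * (√(-2 * t) * C) := by fun_prop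
    have h4 := (ENNReal.continuous_ofReal.comp h3).tendsto 0
    simp only [Function.comp_apply, mul_zero, Real.sqrt_zero, zero_mul, ENNReal.ofReal_zero] at h4
    exact h4.mono_left nhdsWithin_le_nhds
  exact tendsto_of_tendsto_of_tendsto_of_le_of_le' tendsto_const_nhds h2
    (Eventually.of_forall fun _ => zero_le) h1

end Scaling

theorem reflectX2_reflectX2 (P : Plane) : reflectX2 (reflectX2 P) = P :=
  Plane.ext_coord (by simp [reflectX2]) (by simp [reflectX2])

/-- The network of an arc symmetric about the `x²`-axis is symmetric. -/
theorem reflectX2_image_lensNetwork {c : ℝ → Plane}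
    (hc : ∀ x ∈ paramInterval, c (-x) = reflectX2 (c x)) :
    reflectX2 '' lensNetwork c = lensNetwork c := by
  have hneg : ∀ x ∈ paramInterval, -x ∈ paramInterval := fun x hx =>
    ⟨by linarith [hx.2], by linarith [hx.1]⟩
  have hcomm : ∀ P : Plane, reflectX2 (reflectX1 P) = reflectX1 (reflectX2 P) := fun P =>
    Plane.ext_coord (by simp [reflectX1, reflectX2]) (by simp [reflectX1, reflectX2])
  have hend : c (-1) 0 = -c 1 0 := by
    rw [hc 1 one_mem_paramInterval]; simp [reflectX2]
  have hmem : ∀ P ∈ lensNetwork c, reflectX2 P ∈ lensNetwork c := by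
    rintro P (((⟨x, hx, rfl⟩ | ⟨_, ⟨x, hx, rfl⟩, rfl⟩) | ⟨h1, h2⟩) | ⟨h1, h2⟩)
    · exact Or.inl (Or.inl (Or.inl ⟨-x, hneg x hx, hc x hx⟩))
    · refine Or.inl (Or.inl (Or.inr ⟨c (-x), ⟨-x, hneg x hx, rfl⟩, ?_⟩))
      rw [hc x hx, hcomm]
    · refine Or.inr ⟨h1, ?_⟩
      show c 1 0 ≤ -P 0
      linarith
    · refine Or.inl (Or.inr ⟨h1, ?_⟩)
      show -P 0 ≤ c (-1) 0
      linarith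
  apply Subset.antisymm
  · rintro _ ⟨P, hP, rfl⟩
    exact hmem P hP
  · exact fun P hP => ⟨reflectX2 P, hmem P hP, reflectX2_reflectX2 P⟩

theorem theorem1p2 :
    ∃ N : ℝ → Set Plane, IsShrinkingLensFamily N ∧
      (∀ M : ℝ → Set Plane, IsShrinkingLensFamily M → ∀ t < 0, M t = N t) ∧
      (∀ t < 0, reflectX2 '' N t = N t) := by
  obtain ⟨h, p, K, hode⟩ := exists_isLensProfile
  have H : IsExtendedProfile h p := ⟨K, hode⟩
  refine ⟨fun t => lensNetwork fun x => √(-2 * t) • profileArc h p x,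
    ⟨⟨fun t x => √(-2 * t) • profileArc h p x,
      fun t ht => ⟨H.isLensArc.smul (sqrt_neg_two_mul_pos ht), rfl⟩,
      H.isLensArc.isCurveShorteningFlow H.hasShrinkingCurvature⟩,
      shrinksSelfSimilarly_sqrt_smul _, H.isLensArc.convergesToX1Axis⟩,
    fun M hM t ht => hM.eq_standard K ht, fun t _ => reflectX2_image_lensNetwork fun x hx => ?_⟩
  rw [H.even_profileArc hx]
  exact Plane.ext_coord (by simp [reflectX2]) (by simp [reflectX2])
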